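/- Let $\zeta$ be the Riemann zeta function, let $\beta(s)=\sum_{m\ge 0}\frac{(-1)^m}{(2m+1)^s}$ ($\Re s>0$) be Dirichlet's beta function, and let $\operatorname{Li}_s(z)=\sum_{k\ge 1} z^k/k^s$ ($|z|<1$) be the polylogarithm. Let $n\ge 1$ be an integer. (A) Each of the following integrals converges absolutely and is equal to $\sum_{p=1}^{n} C_{p}\,\frac{\zeta(2p+1)}{\pi^{2p}}$ for some rational numbers $C_1,\dots,C_n$ (which depend on the integral, in particular on $n$ and, where it occurs, on $k$): 1. $\displaystyle\int_0^\infty \frac{\sinh((2k+1)x)}{x\cosh^{2n+1}x}\,dx$ for every integer $0\le k\le n-1$; 2. $\displaystyle\int_0^\infty \frac{\sinh(2kx)}{x\cosh^{2n+2}x}\,dx$ for every integer $1\le k\le n$; 3. $\displaystyle\int_0^{\pi/4}\frac{\sin(4nx)}{\ln(\tan x)}\,dx$; 4. $\displaystyle\int_0^1\frac{\operatorname{Li}_{-2n-1}(-x^2)}{x}\,\ln\ln\tfrac1x\,dx$; 5. $\displaystyle\int_0^1\frac{x^{2n-1}}{\operatorname{artanh}x}\,dx$; 6. $\displaystyle\int_0^\infty\frac{\tanh^{2n}x}{x^2}\,dx$;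 7. $\displaystyle\int_0^\infty\frac{\tanh^{n+1}x}{x^{n+1}}\,dx$. (B) Each of the following integrals converges absolutely and is equal to $\sum_{p=1}^{n} C_{p}\,\frac{\beta(2p)}{\pi^{2p-1}}$ for some rational numbers $C_1,\dots,C_n$ (which depend on the integral, in particular on $n$ and, where it occurs, on $k$): 1. $\displaystyle\int_0^\infty \frac{\sinh((2k+1)x)}{x\cosh^{2n}x}\,dx$ for every integer $0\le k\le n-1$; 2. $\displaystyle\int_0^\infty \frac{\sinh(2kx)}{x\cosh^{2n+1}x}\,dx$ for every integer $1\le k\le n$; 3. $\displaystyle\int_0^{\pi/4}\frac{\cos((4n-2)x)}{\ln(\tan x)}\,dx$; 4. $\displaystyle\int_0^1\frac{\operatorname{Im}\left[\operatorname{Li}_{-2n}(ix)\right]}{x}\,\ln\ln\tfrac1x\,dx$; 5. $\displaystyle\int_0^1\frac{x^{2n-1}}{\sqrt{1-x^2}\,\operatorname{artanh}x}\,dx$. -/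

import Mathlib

open MeasureTheory

noncomputable section

/-- Dirichlet's beta function, `β(s) = ∑_{m ≥ 0} (-1)^m / (2m+1)^s`, for `Re s > 0`. The series is
summed in its natural order, so that it converges (conditionally) also for `0 < Re s ≤ 1`. -/
def dirichletBeta (s : ℂ) : ℂ :=
  ∑'[SummationFilter.conditional ℕ] m : ℕ, (-1 : ℂ) ^ m / (2 * (m : ℂ) + 1) ^ s

/-- The polylogarithm (Jonquière's function), `Li_s(z) = ∑_{k ≥ 1} z^k / k^s`, for `|z| < 1`. -/
def polylog (s z : ℂ) : ℂ :=
  ∑' k : ℕ, z ^ (k + 1) / ((k : ℂ) + 1) ^ s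

/-- `I = ∑_{p=1}^n C_p ζ(2p+1) / π^{2p}` with rational coefficients `C_p`. -/
def IsZetaForm (n : ℕ) (I : ℂ) : Prop :=
  ∃ C : ℕ → ℚ, I = ∑ p ∈ Finset.Icc 1 n,
    (C p : ℂ) * (riemannZeta (2 * (p : ℂ) + 1) / (Real.pi : ℂ) ^ (2 * p))

/-- `I = ∑_{p=1}^n C_p β(2p) / π^{2p-1}` with rational coefficients `C_p`. -/
def IsBetaForm (n : ℕ) (I : ℂ) : Prop :=
  ∃ C : ℕ → ℚ, I = ∑ p ∈ Finset.Icc 1 n,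
    (C p : ℂ) * (dirichletBeta (2 * (p : ℂ)) / (Real.pi : ℂ) ^ (2 * p - 1))

/-- The integral of the complex-valued `f` over `s` converges absolutely and its value is
a rational combination of `ζ(2p+1) / π^{2p}`, `1 ≤ p ≤ n`. -/
def HasZetaFormIntegral (n : ℕ) (s : Set ℝ) (f : ℝ → ℂ) : Prop :=
  IntegrableOn f s ∧ IsZetaForm n (∫ x in s, f x)

/-- The integral of the complex-valued `f` over `s` converges absolutely and its value is
a rational combination of `β(2p) / π^{2p-1}`, `1 ≤ p ≤ n`. -/
def HasBetaFormIntegral (n : ℕ) (s : Set ℝ) (f : ℝ → ℂ) : Prop :=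
  IntegrableOn f s ∧ IsBetaForm n (∫ x in s, f x)

end

/-!
All twelve families reduce to the integrals over `(0, ∞)` of `P(tanh x) / (x cosh x ^ e)`, where
`P` is an odd rational polynomial of degree less than `2 n`, with `e = 2` for the `ζ`-forms and
`e = 1` for the `β`-forms (`tanhIntegrand_mem`).

The basic case is `P = D^(2p) X`, where `D` is the operator `tanhDeriv e` with
`(P(tanh x) / cosh x ^ e)' = (D P)(tanh x) / cosh x ^ e`. Differentiating the partial fractions of
`1 / cosh ^ 2` and of `(1 / cosh)'`, which come from the Mittag-Leffler expansion of the cotangent,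
presents `(D^(2p) X)(tanh x) / cosh x ^ e` as a series over the poles `± i a_k`,
`a_k = (k + 1/2) π`, of the pairs `(x + i a_k)^(-m) - (-1)^m (x - i a_k)^(-m)` with
`m = e + 1 + 2 p` and signs `((-1)^e)^k` (`tanhPoly_eq_poleSeries`). Such a pair vanishes at
`x = 0`, and a recursion on `m` gives its integral against `dx / x` as `π i^(1-m) a_k^(-m)`
(`integral_polePair_div`). Summing over `k` yields a rational multiple of `ζ(2p+3) / π^(2p+2)` for
`e = 2` and of `β(2p+2) / π^(2p+1)` for `e = 1` (`exists_integral_tanhPoly_iterate_div`). Since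
`D^2` raises the degree of an odd polynomial by exactly two, the `D^(2p) X` with `p < n` span all
odd polynomials of degree less than `2 n` (`oddPoly_le_derivSpan`).

The given integrals are brought into this form as follows. The quotient `sinh (N x) / cosh x ^ N`
is an odd polynomial in `tanh x` (`sinh_natCast_mul`). The integrals with `artanh` are treated by
`x = tanh u`, and those with `log (tan x)` by `tan x = exp (-u)`, for which `cos 2x = tanh u` and
`sin 2x = 1 / cosh u`. The powers of `tanh x / x` are integrated by parts until the denominator is
`x` (`tanh_pow_div_pow_mem`). With `x = exp (-u)` the polylogarithms of negative order become the
derivatives `(D^m X)(tanh u) / cosh u ^ e` (`expSeries_eq_tanhPoly`), and `log log (1/x) = log u` is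
removed by one integration by parts (`integral_tanhPoly_tanhDeriv_mul_log`).
-/

namespace TanhIntegral

open Filter Topology Set
open scoped Real

/-! ### Partial fractions of `1 / cosh ^ 2` and of the derivative of `1 / cosh` -/

/-- The derivative of the Mittag-Leffler expansion of `π cot (π z)`. -/
theorem hasSum_inv_add_int_sq {z : ℂ} (hz : 0 < z.im) :
    HasSum (fun n : ℤ => ((z + n) ^ 2)⁻¹) ((π : ℂ) ^ 2 / Complex.sin (π * z) ^ 2) := by
  have hs : Summable (fun n : ℤ => ((z + n) ^ 2)⁻¹) := by
    have := EisensteinSeries.linear_right_summable z 1 (k := 2) le_rfl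
    refine this.congr fun n => ?_
    simp [sq]
  have h := iteratedDerivWithin_cot_pi_mul_eq_mul_tsum_div_pow (k := 1) le_rfl
    (z := z) (by simpa using hz)
  have hmem : z ∈ UpperHalfPlane.upperHalfPlaneSet := by simpa using hz
  have hsin : Complex.sin (π * z) ≠ 0 := by
    intro h0
    rw [Complex.sin_eq_zero_iff] at h0
    obtain ⟨k, hk⟩ := h0
    have := congrArg Complex.im hk
    simp [Real.pi_ne_zero] at this
    exact hz.ne' this
  have hd : HasDerivAt (fun x : ℂ => (π : ℂ) * Complex.cot (π * x))
      (-((π : ℂ) ^ 2 / Complex.sin (π * z) ^ 2)) z := by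
    have h1 : HasDerivAt (fun x : ℂ => (π : ℂ) * x) π z := by
      simpa using (hasDerivAt_id z).const_mul (π : ℂ)
    have h2 := ((h1.ccos).div h1.csin hsin).const_mul (π : ℂ)
    have h3 : (fun x : ℂ => (π : ℂ) * Complex.cot (π * x)) =
        fun x => (π : ℂ) * (Complex.cos (π * x) / Complex.sin (π * x)) := by
      ext x; rw [Complex.cot]
    rw [h3]
    refine h2.congr_deriv ?_
    have := Complex.sin_sq_add_cos_sq (π * z)
    field_simp
    linear_combination (-1 : ℂ) * this
  rw [iteratedDerivWithin_one, hd.hasDerivWithinAt.derivWithin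
    (UpperHalfPlane.isOpen_upperHalfPlaneSet.uniqueDiffWithinAt hmem)] at h
  rw [hs.hasSum_iff]
  simp at h
  exact h.symm

/-- The series `∑_{k ∈ ℤ} (x + i π (k + 1/2))^(-2)`, with the terms `k` and `-k-1` paired. -/
theorem hasSum_neg_inv_cosh_sq {x : ℝ} (hx : 0 < x) :
    HasSum (fun k : ℕ => (((x : ℂ) + Complex.I * ((k + 1 / 2) * π)) ^ 2)⁻¹ +
      (((x : ℂ) - Complex.I * ((k + 1 / 2) * π)) ^ 2)⁻¹) (-(1 / (Real.cosh x : ℂ) ^ 2)) := by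
  have hpi : (π : ℂ) ≠ 0 := by exact_mod_cast Real.pi_ne_zero
  have h := hasSum_inv_add_int_sq (z := 1 / 2 + Complex.I * x / π) (by
    have : (1 / 2 + Complex.I * x / π : ℂ) = ((1 / 2 : ℝ) : ℂ) + ((x / π : ℝ) : ℂ) * Complex.I := by
      push_cast; ring
    rw [this]; simp; positivity)
  have h2 := (h.nat_add_neg_add_one).mul_left (-((π : ℂ) ^ 2)⁻¹)
  have hs : Complex.sin (π * (1 / 2 + Complex.I * x / π)) = Real.cosh x := by
    have : (π : ℂ) * (1 / 2 + Complex.I * x / π) = x * Complex.I + π / 2 := by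
      field_simp
      ring
    rw [this, Complex.sin_add_pi_div_two, Complex.cos_mul_I]; push_cast; rfl
  rw [hs] at h2
  convert! h2 using 1
  · ext k
    have key : ∀ w : ℂ, ((π : ℂ) ^ 2)⁻¹ * (w ^ 2)⁻¹ = ((π * w) ^ 2)⁻¹ := fun w => by
      rw [mul_pow, mul_inv]
    have e1 : -((π : ℂ) ^ 2)⁻¹ * (((1 / 2 + Complex.I * x / π + (k : ℤ)) ^ 2)⁻¹ +
        ((1 / 2 + Complex.I * x / π + ((-(k + 1) : ℤ) : ℂ)) ^ 2)⁻¹) =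
        -(((π : ℂ) * (1 / 2 + Complex.I * x / π + (k : ℤ))) ^ 2)⁻¹ -
        ((π * (1 / 2 + Complex.I * x / π + ((-(k + 1) : ℤ) : ℂ))) ^ 2)⁻¹ := by
      rw [← key, ← key]; ring
    rw [e1]
    have e2 : ((π : ℂ) * (1 / 2 + Complex.I * x / π + (k : ℤ))) =
        Complex.I * (x - Complex.I * ((k + 1 / 2) * π)) := by
      field_simp
      push_cast
      linear_combination ((1 : ℂ) + 2 * k) * π * Complex.I_sq
    have e3 : (π * (1 / 2 + Complex.I * x / π + ((-(k + 1) : ℤ) : ℂ))) =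
        Complex.I * (x + Complex.I * ((k + 1 / 2) * π)) := by
      field_simp
      push_cast
      linear_combination (-(1 : ℂ) - 2 * k) * π * Complex.I_sq
    rw [e2, e3, mul_pow, mul_pow, Complex.I_sq]
    simp only [neg_mul, one_mul, inv_neg]; ring
  · field_simp

theorem hasSum_int_of_even_of_odd {f : ℤ → ℂ} {a b : ℂ} (he : HasSum (fun n : ℤ => f (2 * n)) a)
    (ho : HasSum (fun n : ℤ => f (2 * n + 1)) b) : HasSum f (a + b) := by
  have h1 : Function.Injective (fun n : ℤ => 2 * n) := fun a b h => by simpa using h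
  have h2 : Function.Injective (fun n : ℤ => 2 * n + 1) := fun a b h => by simpa using h
  have : IsCompl (Set.range (fun n : ℤ => 2 * n)) (Set.range (fun n : ℤ => 2 * n + 1)) := by
    constructor
    · rw [disjoint_iff_inf_le]
      rintro _ ⟨⟨i, rfl⟩, ⟨j, hj⟩⟩
      simp at hj
      omega
    · rw [codisjoint_iff_le_sup]
      intro i _
      rcases Int.even_or_odd' i with ⟨k, rfl | rfl⟩
      · left; exact ⟨k, rfl⟩
      · right; exact ⟨k, rfl⟩
  exact (h1.hasSum_range_iff.mpr he).add_isCompl this (h2.hasSum_range_iff.mpr ho)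

/-- The series `∑_{k ∈ ℤ} (-1)^k (x + i π (k + 1/2))^(-2)`, with the terms `k` and `-k-1` paired. -/
theorem hasSum_neg_sinh_div_cosh_sq {x : ℝ} (hx : 0 < x) :
    HasSum (fun k : ℕ => (-1 : ℂ) ^ k * ((((x : ℂ) + Complex.I * ((k + 1 / 2) * π)) ^ 2)⁻¹ -
      (((x : ℂ) - Complex.I * ((k + 1 / 2) * π)) ^ 2)⁻¹))
      (-(Complex.I * (Real.sinh x / (Real.cosh x : ℂ) ^ 2))) := by
  have hpi : (π : ℂ) ≠ 0 := by exact_mod_cast Real.pi_ne_zero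
  have him : ∀ c : ℝ, 0 < ((c : ℂ) + Complex.I * x / (2 * π)).im := fun c => by
    have : ((c : ℂ) + Complex.I * x / (2 * π) : ℂ) =
        (c : ℂ) + ((x / (2 * π) : ℝ) : ℂ) * Complex.I := by
      push_cast; ring
    rw [this]
    simp only [Complex.add_im, Complex.ofReal_im, Complex.mul_I_im, Complex.ofReal_re, zero_add]
    positivity
  have h1 := (hasSum_inv_add_int_sq (him (1 / 4))).mul_left (((2 * π : ℂ) ^ 2)⁻¹)
  have h3 := (hasSum_inv_add_int_sq (him (3 / 4))).mul_left (-((2 * π : ℂ) ^ 2)⁻¹)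
  -- the sum over all of `ℤ` splits into the classes of `k` modulo `2`
  let f : ℤ → ℂ := fun k => (-1 : ℂ) ^ k * (((k + 1 / 2) * π + Complex.I * x) ^ 2)⁻¹
  have key : ∀ w : ℂ, ((2 * π : ℂ) ^ 2)⁻¹ * (w ^ 2)⁻¹ = ((2 * π * w) ^ 2)⁻¹ := fun w => by
    rw [mul_pow (2 * π : ℂ) w, mul_inv]
  have hE : ∀ n : ℤ, f (2 * n) = ((2 * π : ℂ) ^ 2)⁻¹ *
      (((((1 / 4 : ℝ) : ℂ) + Complex.I * x / (2 * π) + n) ^ 2)⁻¹) := fun n => by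
    rw [key]
    simp only [f]
    rw [zpow_mul]
    simp only [zpow_ofNat, even_two, Even.neg_pow, one_pow, one_zpow, one_mul]
    congr 2
    push_cast; field_simp; ring
  have hO : ∀ n : ℤ, f (2 * n + 1) = -((2 * π : ℂ) ^ 2)⁻¹ *
      (((((3 / 4 : ℝ) : ℂ) + Complex.I * x / (2 * π) + n) ^ 2)⁻¹) := fun n => by
    rw [neg_mul, key]
    simp only [f]
    rw [show (-1 : ℂ) ^ (2 * n + 1) = -1 by rw [zpow_add₀ (by norm_num), zpow_mul]; simp]
    rw [neg_mul, one_mul]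
    congr 3
    push_cast; field_simp; ring
  rw [← funext hE] at h1
  rw [← funext hO] at h3
  have hf := hasSum_int_of_even_of_odd h1 h3
  have h5 := hf.nat_add_neg_add_one
  convert! h5 using 1
  · ext k
    simp only [f]
    have z1 : (-1 : ℂ) ^ (-((k : ℤ) + 1)) = -(-1) ^ k := by
      rw [zpow_neg, zpow_add₀ (by norm_num)]
      rcases Nat.even_or_odd k with hk | hk <;> simp [hk.neg_one_pow]
    have z2 : (-1 : ℂ) ^ (k : ℤ) = (-1) ^ k := zpow_natCast _ _
    rw [z1, z2]
    have e2 : (((k : ℤ) : ℂ) + 1 / 2) * π + Complex.I * x =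
        Complex.I * (x - Complex.I * ((k + 1 / 2) * π)) := by
      push_cast
      linear_combination ((1 : ℂ) / 2 + k) * π * Complex.I_sq
    have e3 : (((-((k : ℤ) + 1) : ℤ) : ℂ) + 1 / 2) * π + Complex.I * x =
        Complex.I * (x + Complex.I * ((k + 1 / 2) * π)) := by
      push_cast
      linear_combination (-((1 : ℂ) / 2) - k) * π * Complex.I_sq
    rw [e2, e3, mul_pow, mul_pow, Complex.I_sq]
    simp only [neg_mul, one_mul, inv_neg]; ring
  · have s1 : Complex.sin (π * (((1 / 4 : ℝ) : ℂ) + Complex.I * x / (2 * π))) =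
        Complex.sin (x / 2 * Complex.I + π / 4) := by
      congr 1; push_cast; field_simp; ring
    have s3 : Complex.sin (π * (((3 / 4 : ℝ) : ℂ) + Complex.I * x / (2 * π))) =
        Complex.cos (x / 2 * Complex.I + π / 4) := by
      rw [← Complex.sin_add_pi_div_two]
      congr 1; push_cast; field_simp; ring
    rw [s1, s3]
    set y : ℂ := x / 2 * Complex.I + π / 4 with hy
    have t1 : 2 * Complex.sin y * Complex.cos y = Real.cosh x := by
      rw [← Complex.sin_two_mul, hy]
      have : (2 : ℂ) * (x / 2 * Complex.I + π / 4) = x * Complex.I + π / 2 := by ring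
      rw [this, Complex.sin_add_pi_div_two, Complex.cos_mul_I]; push_cast; rfl
    have t2 : Complex.cos y ^ 2 - Complex.sin y ^ 2 = -(Complex.I * Real.sinh x) := by
      rw [← Complex.cos_two_mul', hy]
      have : (2 : ℂ) * (x / 2 * Complex.I + π / 4) = x * Complex.I + π / 2 := by ring
      rw [this, Complex.cos_add_pi_div_two, Complex.sin_mul_I]; push_cast; ring
    have hc : (Real.cosh x : ℂ) ≠ 0 := by exact_mod_cast (Real.cosh_pos x).ne'
    rw [← t1] at hc ⊢
    have hsy : Complex.sin y ≠ 0 := fun h => hc (by rw [h]; ring)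
    have hcy : Complex.cos y ≠ 0 := fun h => hc (by rw [h]; ring)
    have t3 : Complex.I * Real.sinh x = Complex.sin y ^ 2 - Complex.cos y ^ 2 := by
      linear_combination t2
    rw [← mul_div_assoc, t3]
    field_simp
    ring

/-! ### Integrals of pairs of conjugate poles against `dx / x` -/

/-- The pair of poles `(x + ia)^(-m) + δ (x - ia)^(-m)` of order `m` at the points `∓ia`. -/
noncomputable def polePair (δ : ℂ) (a : ℝ) (m : ℕ) (x : ℝ) : ℂ :=
  (((x : ℂ) + Complex.I * a) ^ m)⁻¹ + δ * (((x : ℂ) - Complex.I * a) ^ m)⁻¹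

theorem norm_add_I_mul_sq (x a : ℝ) : ‖(x : ℂ) + Complex.I * a‖ ^ 2 = x ^ 2 + a ^ 2 := by
  rw [mul_comm, Complex.sq_norm, Complex.normSq_add_mul_I]

theorem norm_sub_I_mul (x a : ℝ) : ‖(x : ℂ) - Complex.I * a‖ = ‖(x : ℂ) + Complex.I * a‖ := by
  have h : (x : ℂ) - Complex.I * a = (x : ℂ) + Complex.I * ((-a : ℝ) : ℂ) := by push_cast; ring
  rw [h, ← sq_eq_sq₀ (norm_nonneg _) (norm_nonneg _), norm_add_I_mul_sq, norm_add_I_mul_sq, neg_sq]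

theorem le_norm_add_I_mul (a x : ℝ) : a ≤ ‖(x : ℂ) + Complex.I * a‖ := by
  refine abs_le_of_sq_le_sq' ?_ (norm_nonneg _) |>.2
  rw [norm_add_I_mul_sq]; nlinarith [sq_nonneg x]

theorem add_I_mul_ne_zero {a : ℝ} (ha : 0 < a) (x : ℝ) : (x : ℂ) + Complex.I * a ≠ 0 :=
  norm_pos_iff.mp (ha.trans_le (le_norm_add_I_mul a x))

theorem sub_I_mul_ne_zero {a : ℝ} (ha : 0 < a) (x : ℝ) : (x : ℂ) - Complex.I * a ≠ 0 := by
  rw [← norm_pos_iff, norm_sub_I_mul]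
  exact ha.trans_le (le_norm_add_I_mul a x)

theorem norm_polePair_le {δ : ℂ} (hδ : ‖δ‖ = 1) {a : ℝ} (ha : 0 < a) (m : ℕ) (x : ℝ) :
    ‖polePair δ a m x‖ ≤ 2 * (a ^ m)⁻¹ := by
  have h : (‖(x : ℂ) + Complex.I * a‖ ^ m)⁻¹ ≤ (a ^ m)⁻¹ := by
    gcongr; exact le_norm_add_I_mul a x
  calc ‖polePair δ a m x‖ ≤ _ := norm_add_le _ _
    _ = 2 * (‖(x : ℂ) + Complex.I * a‖ ^ m)⁻¹ := by
        rw [norm_mul, norm_inv, norm_inv, norm_pow, norm_pow, norm_sub_I_mul, hδ]; ring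
    _ ≤ _ := by gcongr

theorem norm_polePair_add_two_le {δ : ℂ} (hδ : ‖δ‖ = 1) {a : ℝ} (ha : 0 < a) (m : ℕ) (x : ℝ) :
    ‖polePair δ a (m + 2) x‖ ≤ 2 * (a ^ m)⁻¹ * (x ^ 2 + a ^ 2)⁻¹ := by
  have h : (‖(x : ℂ) + Complex.I * a‖ ^ m)⁻¹ ≤ (a ^ m)⁻¹ := by
    gcongr; exact le_norm_add_I_mul a x
  calc ‖polePair δ a (m + 2) x‖ ≤ _ := norm_add_le _ _
    _ = 2 * (‖(x : ℂ) + Complex.I * a‖ ^ m)⁻¹ * (x ^ 2 + a ^ 2)⁻¹ := by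
        rw [norm_mul, norm_inv, norm_inv, norm_pow, norm_pow, norm_sub_I_mul, hδ, pow_add,
          norm_add_I_mul_sq, mul_inv]; ring
    _ ≤ _ := by gcongr

theorem hasDerivAt_polePair (δ : ℂ) {a : ℝ} (ha : 0 < a) (m : ℕ) (x : ℝ) :
    HasDerivAt (polePair δ a m) (-m * polePair δ a (m + 1) x) x := by
  have h1 : HasDerivAt (fun x : ℝ => (x : ℂ) + Complex.I * a) 1 x :=
    (Complex.ofRealCLM.hasDerivAt (x := x)).add_const _
  have h2 : HasDerivAt (fun x : ℝ => (x : ℂ) - Complex.I * a) 1 x :=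
    (Complex.ofRealCLM.hasDerivAt (x := x)).sub_const _
  have n1 := add_I_mul_ne_zero ha x
  have n2 := sub_I_mul_ne_zero ha x
  have h := ((h1.pow m).inv (pow_ne_zero m n1)).add
    (((h2.pow m).inv (pow_ne_zero m n2)).const_mul δ)
  refine h.congr_deriv ?_
  rw [polePair]
  rcases m with _ | m
  · simp
  · simp only [Nat.add_sub_cancel, Pi.pow_apply]
    field_simp
    ring

theorem continuous_polePair (δ : ℂ) {a : ℝ} (ha : 0 < a) (m : ℕ) :
    Continuous (polePair δ a m) :=
  continuous_iff_continuousAt.mpr fun x => (hasDerivAt_polePair δ ha m x).continuousAt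

theorem hasDerivAt_arctan_div {a : ℝ} (ha : 0 < a) (x : ℝ) :
    HasDerivAt (fun x => a⁻¹ * Real.arctan (x / a)) ((x ^ 2 + a ^ 2)⁻¹) x := by
  have h := (((hasDerivAt_id x).div_const a).arctan).const_mul a⁻¹
  refine h.congr_deriv ?_
  have : x ^ 2 + a ^ 2 ≠ 0 := by positivity
  have : a ^ 2 + x ^ 2 ≠ 0 := by positivity
  simp only [id]
  field_simp
  ring

theorem tendsto_arctan_div {a : ℝ} (ha : 0 < a) :
    Tendsto (fun x => a⁻¹ * Real.arctan (x / a)) atTop (𝓝 (a⁻¹ * (π / 2))) := by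
  refine Tendsto.const_mul _ ?_
  exact (tendsto_nhds_of_tendsto_nhdsWithin Real.tendsto_arctan_atTop).comp
    (tendsto_id.atTop_div_const ha)

theorem integrableOn_inv_sq_add_sq {a : ℝ} (ha : 0 < a) :
    IntegrableOn (fun x : ℝ => (x ^ 2 + a ^ 2)⁻¹) (Ioi 0) :=
  integrableOn_Ioi_deriv_of_nonneg' (fun x _ => hasDerivAt_arctan_div ha x)
    (fun x _ => by positivity) (tendsto_arctan_div ha)

theorem integral_inv_sq_add_sq {a : ℝ} (ha : 0 < a) :
    ∫ x in Ioi (0 : ℝ), (x ^ 2 + a ^ 2)⁻¹ = a⁻¹ * (π / 2) := by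
  rw [integral_Ioi_of_hasDerivAt_of_tendsto' (fun x _ => hasDerivAt_arctan_div ha x)
    (integrableOn_inv_sq_add_sq ha) (tendsto_arctan_div ha)]
  simp

theorem neg_one_pow_norm (m : ℕ) : ‖(-1 : ℂ) ^ m‖ = 1 := by simp

/-- The antiderivative of this pair is again a pair of poles, which vanishes at `0` and at `∞`. -/
theorem integral_polePair_even {a : ℝ} (ha : 0 < a) (m : ℕ) :
    IntegrableOn (polePair ((-1) ^ m) a (m + 2)) (Ioi 0) ∧
      ∫ x in Ioi (0 : ℝ), polePair ((-1) ^ m) a (m + 2) x = 0 := by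
  have hint : IntegrableOn (polePair ((-1) ^ m) a (m + 2)) (Ioi 0) := by
    refine Integrable.mono' ((integrableOn_inv_sq_add_sq ha).const_mul (2 * (a ^ m)⁻¹))
      (continuous_polePair _ ha _).aestronglyMeasurable (Eventually.of_forall fun x => ?_)
    exact norm_polePair_add_two_le (neg_one_pow_norm m) ha m x
  refine ⟨hint, ?_⟩
  have hd : ∀ x ∈ Ici (0 : ℝ), HasDerivAt
      (fun x => -((m : ℂ) + 1)⁻¹ * polePair ((-1) ^ m) a (m + 1) x)
      (polePair ((-1) ^ m) a (m + 2) x) x := fun x _ => by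
    refine ((hasDerivAt_polePair ((-1) ^ m) ha (m + 1) x).const_mul
      (-((m : ℂ) + 1)⁻¹)).congr_deriv ?_
    have : (m : ℂ) + 1 ≠ 0 := by exact_mod_cast Nat.succ_ne_zero m
    push_cast
    field_simp
  have hp : ∀ s : ℝ, Tendsto (fun x : ℝ => (((x : ℂ) + Complex.I * s) ^ (m + 1))⁻¹)
      atTop (𝓝 0) := by
    intro s
    refine tendsto_inv₀_cobounded.comp ?_
    rw [← tendsto_norm_atTop_iff_cobounded]
    refine tendsto_atTop_mono' _ ?_ tendsto_id
    filter_upwards [eventually_ge_atTop 1] with x hx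
    have : x ≤ ‖(x : ℂ) + Complex.I * s‖ := by
      refine abs_le_of_sq_le_sq' ?_ (norm_nonneg _) |>.2
      rw [norm_add_I_mul_sq]; nlinarith [sq_nonneg s]
    rw [norm_pow]
    exact this.trans (le_self_pow₀ (hx.trans this) (by omega))
  have ht : Tendsto (fun x => -((m : ℂ) + 1)⁻¹ * polePair ((-1) ^ m) a (m + 1) x) atTop (𝓝 0) := by
    have h := ((hp a).add ((hp (-a)).const_mul ((-1 : ℂ) ^ m))).const_mul (-((m : ℂ) + 1)⁻¹)
    simpa [polePair, sub_eq_add_neg] using! h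
  rw [integral_Ioi_of_hasDerivAt_of_tendsto' hd hint ht, polePair]
  have : ((0 : ℝ) - Complex.I * a : ℂ) = -(Complex.I * a) := by simp
  rw [this, neg_pow (Complex.I * (a : ℂ)), mul_inv, ← mul_assoc, pow_succ (-1 : ℂ)]
  rcases Nat.even_or_odd m with hk | hk <;> simp [hk.neg_one_pow]

/-- Partial fractions: `1 / (x (x ± ia))` splits, which lowers the order of the pair by one. -/
theorem polePair_div_succ {a : ℝ} (ha : 0 < a) (m : ℕ) {x : ℝ} (hx : x ≠ 0) :
    polePair ((-1) ^ (m + 1)) a (m + 2) x / x = (Complex.I * a)⁻¹ *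
      (polePair ((-1) ^ m) a (m + 1) x / x - polePair ((-1) ^ m) a (m + 2) x) := by
  have n1 := add_I_mul_ne_zero ha x
  have n2 := sub_I_mul_ne_zero ha x
  have n3 : (x : ℂ) ≠ 0 := by exact_mod_cast hx
  have n4 : (a : ℂ) ≠ 0 := by exact_mod_cast ha.ne'
  simp only [polePair]
  field_simp
  ring

/-- This bound gives both integrability and, through its factor `a ^ (-m)`, summability over the
poles. -/
theorem norm_polePair_div_le {a : ℝ} (ha : 0 < a) (m : ℕ) {x : ℝ} (hx : x ≠ 0) :
    ‖polePair ((-1) ^ m) a (m + 1) x / x‖ ≤ 2 * (m + 1) * (a ^ m)⁻¹ * (x ^ 2 + a ^ 2)⁻¹ := by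
  induction m with
  | zero =>
    have n1 := add_I_mul_ne_zero ha x
    have n2 := sub_I_mul_ne_zero ha x
    have n3 : (x : ℂ) ≠ 0 := by exact_mod_cast hx
    have h : polePair ((-1) ^ 0) a (0 + 1) x / x = ((2 * (x ^ 2 + a ^ 2)⁻¹ : ℝ) : ℂ) := by
      have n5 : (x : ℂ) ^ 2 + a ^ 2 = (x + Complex.I * a) * (x - Complex.I * a) := by
        linear_combination (a : ℂ) ^ 2 * Complex.I_sq
      push_cast
      rw [polePair, n5]
      field_simp
      ring
    rw [h, Complex.norm_real, Real.norm_of_nonneg (by positivity)]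
    simp
  | succ m ih =>
    rw [polePair_div_succ ha m hx, norm_mul, norm_inv, norm_mul, Complex.norm_I, one_mul,
      Complex.norm_real, Real.norm_of_nonneg ha.le]
    calc _ ≤ a⁻¹ * (2 * (m + 1) * (a ^ m)⁻¹ * (x ^ 2 + a ^ 2)⁻¹ +
        2 * (a ^ m)⁻¹ * (x ^ 2 + a ^ 2)⁻¹) := by
          gcongr
          exact (norm_sub_le _ _).trans
            (add_le_add ih (norm_polePair_add_two_le (neg_one_pow_norm m) ha m x))
      _ = _ := by push_cast; rw [pow_succ a m, mul_inv]; ring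

theorem integrableOn_polePair_div {a : ℝ} (ha : 0 < a) (m : ℕ) :
    IntegrableOn (fun x : ℝ => polePair ((-1) ^ m) a (m + 1) x / x) (Ioi 0) := by
  refine Integrable.mono' ((integrableOn_inv_sq_add_sq ha).const_mul (2 * (m + 1) * (a ^ m)⁻¹))
    ?_ ((ae_restrict_mem measurableSet_Ioi).mono fun x hx => ?_)
  · refine ContinuousOn.aestronglyMeasurable ?_ measurableSet_Ioi
    refine (continuous_polePair _ ha _).continuousOn.div Complex.continuous_ofReal.continuousOn ?_
    intro x hx
    exact_mod_cast (mem_Ioi.mp hx).ne'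
  · exact norm_polePair_div_le ha m (mem_Ioi.mp hx).ne'

theorem integral_norm_polePair_div_le {a : ℝ} (ha : 0 < a) (m : ℕ) :
    ∫ x in Ioi (0 : ℝ), ‖polePair ((-1) ^ m) a (m + 1) x / x‖ ≤ π * (m + 1) * (a ^ (m + 1))⁻¹ := by
  calc _ ≤ ∫ x in Ioi (0 : ℝ), 2 * (m + 1) * (a ^ m)⁻¹ * (x ^ 2 + a ^ 2)⁻¹ :=
        setIntegral_mono_on (integrableOn_polePair_div ha m).norm
          ((integrableOn_inv_sq_add_sq ha).const_mul _) measurableSet_Ioi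
          fun x hx => norm_polePair_div_le ha m (mem_Ioi.mp hx).ne'
    _ = _ := by
      rw [integral_const_mul, integral_inv_sq_add_sq ha, pow_succ, mul_inv]; ring

/-- For `δ = (-1)^m` the pair of order `m + 1` vanishes at `x = 0`, so that it can be integrated
against `dx / x`. -/
theorem integral_polePair_div {a : ℝ} (ha : 0 < a) (m : ℕ) :
    ∫ x in Ioi (0 : ℝ), polePair ((-1) ^ m) a (m + 1) x / x =
      π * (Complex.I ^ m)⁻¹ * ((a : ℂ) ^ (m + 1))⁻¹ := by
  induction m with
  | zero =>
    have h : ∀ x ∈ Ioi (0 : ℝ), polePair ((-1) ^ 0) a (0 + 1) x / x =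
        ((2 * (x ^ 2 + a ^ 2)⁻¹ : ℝ) : ℂ) := fun x hx => by
      have n1 := add_I_mul_ne_zero ha x
      have n2 := sub_I_mul_ne_zero ha x
      have n3 : (x : ℂ) ≠ 0 := by exact_mod_cast (mem_Ioi.mp hx).ne'
      have n5 : (x : ℂ) ^ 2 + a ^ 2 = (x + Complex.I * a) * (x - Complex.I * a) := by
        linear_combination (a : ℂ) ^ 2 * Complex.I_sq
      push_cast
      rw [polePair, n5]
      field_simp
      ring
    rw [setIntegral_congr_fun measurableSet_Ioi h, integral_complex_ofReal, integral_const_mul,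
      integral_inv_sq_add_sq ha]
    push_cast
    simp
    ring
  | succ m ih =>
    rw [setIntegral_congr_fun measurableSet_Ioi
      (fun x hx => polePair_div_succ ha m (mem_Ioi.mp hx).ne'), integral_const_mul,
      integral_sub (integrableOn_polePair_div ha m) (integral_polePair_even ha m).1,
      (integral_polePair_even ha m).2, ih, pow_succ Complex.I, pow_succ (a : ℂ) (m + 1)]
    simp only [mul_inv]
    ring

/-! ### Polynomials in `tanh` divided by powers of `cosh` -/

section HyperbolicPolynomials
open Polynomial

/-- The function `P(tanh x) / cosh x ^ e` attached to a rational polynomial `P`. -/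
noncomputable def tanhPoly (e : ℕ) (P : ℚ[X]) (x : ℝ) : ℝ :=
  aeval (Real.tanh x) P / Real.cosh x ^ e

/-- The operator on polynomials which corresponds to differentiation of `tanhPoly e`. -/
noncomputable def tanhDeriv (e : ℕ) : ℚ[X] →ₗ[ℚ] ℚ[X] :=
  LinearMap.mulLeft ℚ (1 - X ^ 2) ∘ₗ derivative - (e : ℚ) • LinearMap.mulLeft ℚ X

theorem tanhDeriv_apply (e : ℕ) (P : ℚ[X]) :
    tanhDeriv e P = (1 - X ^ 2) * derivative P - (e : ℚ) • (X * P) := rfl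

theorem one_sub_tanh_sq (x : ℝ) : 1 - Real.tanh x ^ 2 = 1 / Real.cosh x ^ 2 := by
  have h := (Real.cosh_pos x).ne'
  rw [Real.tanh_eq_sinh_div_cosh]
  field_simp
  linarith [Real.cosh_sq x]

theorem hasDerivAt_tanh (x : ℝ) : HasDerivAt Real.tanh (1 / Real.cosh x ^ 2) x := by
  have h := (Real.hasDerivAt_sinh x).div (Real.hasDerivAt_cosh x) (Real.cosh_pos x).ne'
  have h2 : Real.tanh = Real.sinh / Real.cosh := by
    ext y; simp [Real.tanh_eq_sinh_div_cosh]
  rw [h2]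
  refine h.congr_deriv ?_
  congr 1
  linarith [Real.cosh_sq x]

theorem hasDerivAt_tanhPoly (e : ℕ) (P : ℚ[X]) (x : ℝ) :
    HasDerivAt (tanhPoly e P) (tanhPoly e (tanhDeriv e P) x) x := by
  have hc := (Real.cosh_pos x).ne'
  have h1 : HasDerivAt (fun x => aeval (Real.tanh x) P)
      (aeval (Real.tanh x) (derivative P) * (1 / Real.cosh x ^ 2)) x :=
    (Polynomial.hasDerivAt_aeval P (Real.tanh x)).comp x (hasDerivAt_tanh x)
  have h := h1.div ((Real.hasDerivAt_cosh x).pow e) (pow_ne_zero e hc)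
  refine h.congr_deriv ?_
  simp only [Pi.pow_apply]
  rw [tanhPoly, tanhDeriv_apply, map_sub, map_mul, map_smul, map_mul, map_sub, map_pow, map_one,
    aeval_X, one_sub_tanh_sq, Real.tanh_eq_sinh_div_cosh]
  rcases e with _ | e
  · simp [mul_comm]
  · simp only [Nat.add_sub_cancel, Rat.smul_def]
    push_cast
    field_simp
    ring

theorem continuous_tanhPoly (e : ℕ) (P : ℚ[X]) : Continuous (tanhPoly e P) :=
  continuous_iff_continuousAt.mpr fun x => (hasDerivAt_tanhPoly e P x).continuousAt

theorem exists_abs_tanhPoly_le {e : ℕ} (he : 1 ≤ e) (P : ℚ[X]) :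
    ∃ C, 0 ≤ C ∧ ∀ x, |tanhPoly e P x| ≤ C * Real.exp (-x) := by
  obtain ⟨C, hC⟩ := (isCompact_Icc (a := (-1 : ℝ)) (b := 1)).exists_bound_of_continuousOn
    (f := fun t : ℝ => aeval t P) (Polynomial.continuous_aeval P).continuousOn
  have hC0 : 0 ≤ C := (norm_nonneg _).trans (hC 0 (by norm_num))
  refine ⟨C * 2, by positivity, fun x => ?_⟩
  have h1 := hC (Real.tanh x) ⟨(Real.neg_one_lt_tanh x).le, (Real.tanh_lt_one x).le⟩
  have h2 : Real.exp x / 2 ≤ Real.cosh x ^ e :=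
    le_trans (by rw [Real.cosh_eq]; linarith [Real.exp_pos (-x)])
      (le_self_pow₀ (Real.one_le_cosh x) (by omega))
  rw [tanhPoly, abs_div, abs_of_pos (pow_pos (Real.cosh_pos x) e), Real.exp_neg, mul_assoc]
  rw [Real.norm_eq_abs] at h1
  calc _ ≤ C / (Real.exp x / 2) := by gcongr
    _ = _ := by field_simp

theorem tanh_le_self {x : ℝ} (hx : 0 ≤ x) : Real.tanh x ≤ x := by
  have h : Monotone fun x => x - Real.tanh x := by
    refine monotone_of_hasDerivAt_nonneg (fun x => (hasDerivAt_id x).sub (hasDerivAt_tanh x))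
      fun x => ?_
    have := one_sub_tanh_sq x
    simp only [Pi.zero_apply]
    nlinarith [sq_nonneg (Real.tanh x)]
  have := h hx
  simp at this
  exact this

theorem tanh_nonneg {x : ℝ} (hx : 0 ≤ x) : 0 ≤ Real.tanh x := by
  rw [Real.tanh_eq_sinh_div_cosh]
  exact div_nonneg (Real.sinh_nonneg_iff.mpr hx) (Real.cosh_pos x).le

theorem exists_abs_tanhPoly_le_mul {e : ℕ} (he : 1 ≤ e) {P : ℚ[X]} (hP : P.eval 0 = 0) :
    ∃ C, 0 ≤ C ∧ ∀ x, 0 ≤ x → |tanhPoly e P x| ≤ C * x * Real.exp (-x) := by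
  obtain ⟨Q, rfl⟩ : X ∣ P := by rwa [X_dvd_iff, coeff_zero_eq_eval_zero]
  obtain ⟨C, hC0, hC⟩ := exists_abs_tanhPoly_le he Q
  refine ⟨C, hC0, fun x hx => ?_⟩
  have h : tanhPoly e (X * Q) x = Real.tanh x * tanhPoly e Q x := by
    simp [tanhPoly, mul_div_assoc]
  rw [h, abs_mul, abs_of_nonneg (tanh_nonneg hx)]
  calc _ ≤ x * (C * Real.exp (-x)) :=
        mul_le_mul (tanh_le_self hx) (hC x) (abs_nonneg _) hx
    _ = _ := by ring

theorem integrableOn_tanhPoly_div {e : ℕ} (he : 1 ≤ e) {P : ℚ[X]} (hP : P.eval 0 = 0) :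
    IntegrableOn (fun x => ((tanhPoly e P x / x : ℝ) : ℂ)) (Ioi 0) := by
  obtain ⟨C, hC0, hC⟩ := exists_abs_tanhPoly_le_mul he hP
  suffices h : IntegrableOn (fun x => tanhPoly e P x / x) (Ioi 0) from h.ofReal
  refine Integrable.mono' ((integrableOn_exp_neg_Ioi 0).const_mul C) ?_
    ((ae_restrict_mem measurableSet_Ioi).mono fun x hx => ?_)
  · exact ((continuous_tanhPoly e P).continuousOn.div continuousOn_id
      fun x hx => (mem_Ioi.mp hx).ne').aestronglyMeasurable measurableSet_Ioi
  · have hx : 0 < x := hx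
    rw [Real.norm_eq_abs, abs_div, abs_of_pos hx, div_le_iff₀ hx]
    linarith [hC x hx.le]

/-- Parity: `tanhDeriv e` exchanges even and odd polynomials. -/
theorem tanhDeriv_comp_neg (e : ℕ) (P : ℚ[X]) :
    (tanhDeriv e P).comp (-X) = -tanhDeriv e (P.comp (-X)) := by
  simp only [tanhDeriv_apply, sub_comp, mul_comp, one_comp, pow_comp, X_comp, smul_comp,
    derivative_comp, derivative_neg, derivative_X]
  simp only [smul_eq_C_mul]
  ring

theorem tanhDeriv_iterate_comp_neg (e p : ℕ) :
    (((tanhDeriv e)^[p]) X).comp (-X) = (-1) ^ (p + 1) * ((tanhDeriv e)^[p]) X := by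
  induction p with
  | zero => simp
  | succ p ih =>
    rw [Function.iterate_succ_apply', tanhDeriv_comp_neg, ih, pow_succ _ (p + 1)]
    rcases Nat.even_or_odd (p + 1) with h | h <;> simp [h.neg_one_pow]

theorem eval_zero_tanhDeriv_iterate (e p : ℕ) : (((tanhDeriv e)^[2 * p]) X).eval 0 = 0 := by
  have h := congrArg (Polynomial.eval 0) (tanhDeriv_iterate_comp_neg e (2 * p))
  have h1 : (-1 : ℚ[X]) ^ (2 * p + 1) = -1 := (Odd.neg_one_pow ⟨p, rfl⟩)
  rw [h1] at h
  simp [eval_comp] at h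
  linarith

/-- The odd polynomials of degree less than `2 * n`. -/
noncomputable def oddPoly (n : ℕ) : Submodule ℚ ℚ[X] :=
  Submodule.span ℚ ((fun i : ℕ => X ^ (2 * i + 1)) '' Iio n)

/-- The span of the images of `X` under the first `n` powers of the second derivative. -/
noncomputable def derivSpan (e n : ℕ) : Submodule ℚ ℚ[X] :=
  Submodule.span ℚ ((fun i : ℕ => ((tanhDeriv e)^[2 * i]) X) '' Iio n)

theorem derivSpan_mono (e : ℕ) {m n : ℕ} (h : m ≤ n) : derivSpan e m ≤ derivSpan e n :=
  Submodule.span_mono (image_mono (Iio_subset_Iio h))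

theorem tanhDeriv_tanhDeriv_mem (e n : ℕ) {P : ℚ[X]} (hP : P ∈ derivSpan e n) :
    tanhDeriv e (tanhDeriv e P) ∈ derivSpan e (n + 1) := by
  have : derivSpan e n ≤ (derivSpan e (n + 1)).comap (tanhDeriv e ∘ₗ tanhDeriv e) := by
    refine Submodule.span_le.mpr ?_
    rintro _ ⟨i, hi, rfl⟩
    rw [SetLike.mem_coe, Submodule.mem_comap, LinearMap.comp_apply,
      ← Function.iterate_succ_apply' (tanhDeriv e), ← Function.iterate_succ_apply' (tanhDeriv e)]
    exact Submodule.subset_span ⟨i + 1, Nat.succ_lt_succ hi, rfl⟩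
  exact this hP

/-- Applied twice, this shows that the second derivative raises degrees by exactly two. -/
theorem tanhDeriv_X_pow_succ (e j : ℕ) :
    tanhDeriv e (X ^ (j + 1)) =
      ((j + 1 : ℕ) : ℚ) • X ^ j - ((j + 1 + e : ℕ) : ℚ) • X ^ (j + 2) := by
  rw [tanhDeriv_apply]
  simp only [derivative_X_pow, Nat.add_sub_cancel, smul_eq_C_mul]
  simp only [Nat.cast_add, map_add, map_natCast, Nat.cast_one, map_one]
  ring

theorem tanhDeriv_one (e : ℕ) : tanhDeriv e 1 = -((e : ℚ) • X) := by
  rw [tanhDeriv_apply]; simp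

theorem X_pow_mem_derivSpan (e i : ℕ) : (X : ℚ[X]) ^ (2 * i + 1) ∈ derivSpan e (i + 1) := by
  induction i using Nat.strong_induction_on with
  | _ i ih =>
    rcases i with _ | i
    · exact Submodule.subset_span ⟨0, by simp, by simp⟩
    · -- the second derivative of `X ^ (2 * i + 1)` involves `X ^ (2 * i + 3)` and lower powers
      have h1 := derivSpan_mono e (Nat.le_succ (i + 1)) (ih i (by omega))
      have h2 := tanhDeriv_tanhDeriv_mem e _ (ih i (by omega))
      have hc : (((2 * i + 1 + e : ℕ) : ℚ) * ((2 * i + 2 + e : ℕ) : ℚ)) ≠ 0 := by positivity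
      rw [← Submodule.smul_mem_iff _ hc]
      rcases i with _ | i
      · have : (((2 * 0 + 1 + e : ℕ) : ℚ) * ((2 * 0 + 2 + e : ℕ) : ℚ)) •
              (X : ℚ[X]) ^ (2 * (0 + 1) + 1)
            = tanhDeriv e (tanhDeriv e (X ^ (2 * 0 + 1))) +
              ((3 * e + 2 : ℕ) : ℚ) • X ^ (2 * 0 + 1) := by
          rw [tanhDeriv_X_pow_succ, map_sub, map_smul, map_smul, tanhDeriv_X_pow_succ e 1]
          simp only [mul_zero, pow_zero, tanhDeriv_one, smul_eq_C_mul]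
          simp only [Nat.cast_add, Nat.cast_mul, map_mul, map_add, map_natCast]
          push_cast
          ring
        rw [this]
        exact add_mem h2 (Submodule.smul_mem _ _ h1)
      · have h3 := derivSpan_mono e (Nat.le_succ_of_le (Nat.le_succ (i + 1))) (ih i (by omega))
        have : (((2 * (i + 1) + 1 + e : ℕ) : ℚ) * ((2 * (i + 1) + 2 + e : ℕ) : ℚ)) •
              (X : ℚ[X]) ^ (2 * (i + 1 + 1) + 1)
            = tanhDeriv e (tanhDeriv e (X ^ (2 * (i + 1) + 1))) +
              ((2 * i + 3 : ℕ) * (2 * i + 2 + e : ℕ) + (2 * i + 3 + e : ℕ) * (2 * i + 4 : ℕ) : ℚ) •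
                X ^ (2 * (i + 1) + 1) -
              ((2 * i + 3 : ℕ) * (2 * i + 2 : ℕ) : ℚ) • X ^ (2 * i + 1) := by
          rw [tanhDeriv_X_pow_succ, map_sub, map_smul, map_smul, tanhDeriv_X_pow_succ,
            show 2 * (i + 1) = 2 * i + 1 + 1 by ring, tanhDeriv_X_pow_succ]
          simp only [smul_eq_C_mul]
          simp only [Nat.cast_add, Nat.cast_mul, map_mul, map_add, map_natCast]
          push_cast
          ring
        rw [this]
        exact sub_mem (add_mem h2 (Submodule.smul_mem _ _ h1)) (Submodule.smul_mem _ _ h3)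

theorem oddPoly_le_derivSpan (e n : ℕ) : oddPoly n ≤ derivSpan e n := by
  refine Submodule.span_le.mpr ?_
  rintro _ ⟨i, hi, rfl⟩
  exact derivSpan_mono e (Nat.succ_le_of_lt hi) (X_pow_mem_derivSpan e i)

theorem oddPoly_mono {m n : ℕ} (h : m ≤ n) : oddPoly m ≤ oddPoly n :=
  Submodule.span_mono (image_mono (Iio_subset_Iio h))

theorem X_pow_mem_oddPoly {i n : ℕ} (h : i < n) : (X : ℚ[X]) ^ (2 * i + 1) ∈ oddPoly n :=
  Submodule.subset_span ⟨i, h, rfl⟩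

theorem X_mem_oddPoly {n : ℕ} (h : 0 < n) : (X : ℚ[X]) ∈ oddPoly n := by
  simpa using X_pow_mem_oddPoly h

theorem X_sq_mul_mem_oddPoly {n : ℕ} {P : ℚ[X]} (hP : P ∈ oddPoly n) :
    X ^ 2 * P ∈ oddPoly (n + 1) := by
  have : oddPoly n ≤ (oddPoly (n + 1)).comap (LinearMap.mulLeft ℚ (X ^ 2)) := by
    refine Submodule.span_le.mpr ?_
    rintro _ ⟨i, hi, rfl⟩
    rw [SetLike.mem_coe, Submodule.mem_comap, LinearMap.mulLeft_apply, ← pow_add,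
      show 2 + (2 * i + 1) = 2 * (i + 1) + 1 by ring]
    exact X_pow_mem_oddPoly (Nat.succ_lt_succ hi)
  exact this hP

end HyperbolicPolynomials

/-! ### The partial fraction series of the derivatives of `tanh / cosh ^ e` -/

section Series
open Polynomial

/-- The distance from `0` of the `k`-th pair of poles of `1 / cosh`. -/
noncomputable def poleDist (k : ℕ) : ℝ := (k + 1 / 2) * π

theorem poleDist_pos (k : ℕ) : 0 < poleDist k := by
  unfold poleDist; positivity

theorem summable_inv_poleDist_pow {m : ℕ} (hm : 2 ≤ m) :
    Summable fun k : ℕ => (poleDist k ^ m)⁻¹ := by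
  have h : Summable fun k : ℕ => (((k + 1 : ℕ) : ℝ) ^ m)⁻¹ :=
    (Real.summable_nat_pow_inv.mpr (by omega)).comp_injective (add_left_injective 1)
  refine Summable.of_nonneg_of_le (fun k => (inv_pos.mpr (pow_pos (poleDist_pos k) m)).le)
    (fun k => ?_) h
  have : ((k + 1 : ℕ) : ℝ) ≤ poleDist k := by
    have := Real.pi_gt_three
    unfold poleDist
    push_cast
    nlinarith [(Nat.cast_nonneg k : (0 : ℝ) ≤ k)]
  gcongr

/-- The series `∑_k ((-1)^e)^k ((x + i a_k)^(-m) + (-1)^e (x - i a_k)^(-m))`, where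
`a_k = (k + 1/2) π`. -/
noncomputable def poleSeries (e m : ℕ) (x : ℝ) : ℂ :=
  ∑' k : ℕ, ((-1 : ℂ) ^ e) ^ k * polePair ((-1) ^ e) (poleDist k) m x

theorem norm_poleSeries_term_le (e m k : ℕ) (x : ℝ) :
    ‖((-1 : ℂ) ^ e) ^ k * polePair ((-1) ^ e) (poleDist k) m x‖ ≤ 2 * (poleDist k ^ m)⁻¹ := by
  rw [norm_mul, norm_pow, neg_one_pow_norm, one_pow, one_mul]
  exact norm_polePair_le (neg_one_pow_norm e) (poleDist_pos k) m x

theorem hasDerivAt_poleSeries (e : ℕ) {m : ℕ} (hm : 2 ≤ m) (x : ℝ) :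
    HasDerivAt (poleSeries e m) (-m * poleSeries e (m + 1) x) x := by
  have hu : Summable fun k => (m : ℝ) * (2 * (poleDist k ^ (m + 1))⁻¹) :=
    ((summable_inv_poleDist_pow (by omega)).mul_left 2).mul_left _
  have h := hasDerivAt_tsum (𝕜 := ℝ) (y₀ := 0) hu
    (g := fun k x => ((-1 : ℂ) ^ e) ^ k * polePair ((-1) ^ e) (poleDist k) m x)
    (g' := fun k x => -m * (((-1 : ℂ) ^ e) ^ k * polePair ((-1) ^ e) (poleDist k) (m + 1) x))
    (fun k y => ((hasDerivAt_polePair _ (poleDist_pos k) m y).const_mul _).congr_deriv (by ring))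
    (fun k y => by
      rw [norm_mul, norm_neg, Complex.norm_natCast]
      gcongr
      exact norm_poleSeries_term_le e (m + 1) k y)
    (.of_norm_bounded ((summable_inv_poleDist_pow hm).mul_left 2)
      fun k => norm_poleSeries_term_le e m k 0) x
  rw [tsum_mul_left] at h
  exact h

theorem eq_deriv_of_eqOn_Ioi {E : Type*} [NormedAddCommGroup E] [NormedSpace ℝ E]
    {f g : ℝ → E} {f' g' : E} {x : ℝ} (hx : 0 < x) (h : ∀ y, 0 < y → f y = g y)
    (hf : HasDerivAt f f' x) (hg : HasDerivAt g g' x) : f' = g' :=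
  hf.unique (hg.congr_of_eventuallyEq
    ((eventually_gt_nhds hx).mono fun y hy => h y hy))

theorem hasDerivAt_tanhPoly_ofReal (e : ℕ) (P : ℚ[X]) (x : ℝ) :
    HasDerivAt (fun x => (tanhPoly e P x : ℂ)) (tanhPoly e (tanhDeriv e P) x : ℂ) x :=
  (hasDerivAt_tanhPoly e P x).ofReal_comp

/-- Repeated differentiation of the series for `m = 0`. -/
theorem tanhPoly_eq_poleSeries {e : ℕ} (he : 1 ≤ e) {c : ℂ}
    (h : ∀ x, 0 < x → (tanhPoly e X x : ℂ) = c * poleSeries e (e + 1) x) (m : ℕ) :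
    ∀ x, 0 < x → (tanhPoly e ((tanhDeriv e)^[m] X) x : ℂ) =
      c * (-1) ^ m * (e + 1).ascFactorial m * poleSeries e (e + 1 + m) x := by
  induction m with
  | zero => simpa using h
  | succ m ih =>
    intro x hx
    rw [Function.iterate_succ_apply']
    rw [← add_assoc, eq_deriv_of_eqOn_Ioi hx ih (hasDerivAt_tanhPoly_ofReal e _ x)
      ((hasDerivAt_poleSeries e (m := e + 1 + m) (by omega) x).const_mul _), Nat.ascFactorial_succ,
      pow_succ]
    push_cast
    ring

theorem tanhPoly_two_X {x : ℝ} (hx : 0 < x) :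
    (tanhPoly 2 X x : ℂ) = -1 * poleSeries 2 (2 + 1) x := by
  have h : ∀ y : ℝ, 0 < y → poleSeries 2 2 y = ((tanhPoly 2 (-1) y : ℝ) : ℂ) := fun y hy => by
    have h1 := (hasSum_neg_inv_cosh_sq hy).tsum_eq
    rw [poleSeries]
    simp only [polePair, poleDist, tanhPoly]
    push_cast at h1 ⊢
    simpa [neg_div] using h1
  have h2 := eq_deriv_of_eqOn_Ioi hx h (hasDerivAt_poleSeries 2 le_rfl x)
    (hasDerivAt_tanhPoly_ofReal 2 _ x)
  have h3 : tanhDeriv 2 (-1) = (2 : ℚ) • X := by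
    rw [map_neg, tanhDeriv_one]; simp
  have h4 : tanhPoly 2 ((2 : ℚ) • X) x = 2 * tanhPoly 2 X x := by
    simp [tanhPoly, Rat.smul_def, mul_div_assoc]
  rw [h3, h4] at h2
  push_cast at h2
  linear_combination (-1 / 2 : ℂ) * h2

theorem tanhPoly_one_X {x : ℝ} (hx : 0 < x) :
    (tanhPoly 1 X x : ℂ) = Complex.I * poleSeries 1 (1 + 1) x := by
  have h1 := (hasSum_neg_sinh_div_cosh_sq hx).tsum_eq
  have h2 : poleSeries 1 (1 + 1) x = -(Complex.I * (tanhPoly 1 X x : ℂ)) := by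
    rw [poleSeries]
    simp only [polePair, poleDist, tanhPoly]
    convert! h1 using 2
    · ext k; push_cast; ring
    · simp only [aeval_X, Real.tanh_eq_sinh_div_cosh]; push_cast; rw [div_div, pow_one, sq]
  rw [h2]
  linear_combination (tanhPoly 1 X x : ℂ) * Complex.I_sq

/-- The basic integral: summing the integrals of the pairs of poles gives a Dirichlet series. -/
theorem integral_poleSeries_div (e : ℕ) (he : 1 ≤ e) (p : ℕ) :
    ∫ x in Ioi (0 : ℝ), poleSeries e (e + 1 + 2 * p) x / x =
      π * (Complex.I ^ (e + 2 * p))⁻¹ *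
        ∑' k : ℕ, ((-1 : ℂ) ^ e) ^ k * ((poleDist k : ℂ) ^ (e + 2 * p + 1))⁻¹ := by
  have hd : (-1 : ℂ) ^ e = (-1) ^ (e + 2 * p) := by
    rw [pow_add, pow_mul]; simp
  have hm : e + 1 + 2 * p = e + 2 * p + 1 := by ring
  set m := e + 2 * p with hmdef
  have hF : ∀ k : ℕ, IntegrableOn
      (fun x : ℝ => ((-1 : ℂ) ^ e) ^ k * (polePair ((-1) ^ m) (poleDist k) (m + 1) x / x))
      (Ioi 0) := fun k => (integrableOn_polePair_div (poleDist_pos k) m).const_mul _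
  have hs : Summable fun k : ℕ => ∫ x in Ioi (0 : ℝ),
      ‖((-1 : ℂ) ^ e) ^ k * (polePair ((-1) ^ m) (poleDist k) (m + 1) x / x)‖ := by
    refine ((summable_inv_poleDist_pow (m := m + 1) (by omega)).mul_left
      (π * (m + 1))).of_nonneg_of_le (fun k => integral_nonneg fun x => norm_nonneg _) fun k => ?_
    simp only [norm_mul, norm_pow, norm_neg, norm_one, one_pow, one_mul]
    simpa only [norm_mul] using integral_norm_polePair_div_le (poleDist_pos k) m
  have h := integral_tsum_of_summable_integral_norm hF hs
  have hl : ∀ x : ℝ, poleSeries e (e + 1 + 2 * p) x / x =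
      ∑' k : ℕ, ((-1 : ℂ) ^ e) ^ k * (polePair ((-1) ^ m) (poleDist k) (m + 1) x / x) := fun x => by
    rw [poleSeries, ← tsum_div_const, hm, hd]
    exact tsum_congr fun k => mul_div_assoc _ _ _
  simp_rw [hl]
  rw [← h, ← tsum_mul_left]
  refine tsum_congr fun k => ?_
  rw [integral_const_mul, integral_polePair_div (poleDist_pos k)]
  ring

/-- The Dirichlet series `∑_k ((-1)^e)^k / (2k+1)^m`. -/
noncomputable def oddSeries (e m : ℕ) : ℂ :=
  ∑' k : ℕ, ((-1 : ℂ) ^ e) ^ k * ((2 * (k : ℂ) + 1) ^ m)⁻¹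

theorem tsum_inv_poleDist (e m : ℕ) :
    ∑' k : ℕ, ((-1 : ℂ) ^ e) ^ k * ((poleDist k : ℂ) ^ m)⁻¹ =
      2 ^ m / (π : ℂ) ^ m * oddSeries e m := by
  rw [oddSeries, ← tsum_mul_left]
  refine tsum_congr fun k => ?_
  have : (poleDist k : ℂ) = (2 * k + 1) * (π / 2) := by
    unfold poleDist; push_cast; ring
  rw [this, mul_pow, div_pow, mul_inv, inv_div]
  ring

theorem integral_tanhPoly_iterate_div {e : ℕ} (he : 1 ≤ e) {c : ℂ}
    (h : ∀ x, 0 < x → (tanhPoly e X x : ℂ) = c * poleSeries e (e + 1) x) (p : ℕ) :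
    ∫ x in Ioi (0 : ℝ), ((tanhPoly e ((tanhDeriv e)^[2 * p] X) x / x : ℝ) : ℂ) =
      (e + 1).ascFactorial (2 * p) * 2 ^ (e + 2 * p + 1) * (c * (Complex.I ^ (e + 2 * p))⁻¹) *
        (oddSeries e (e + 2 * p + 1) / (π : ℂ) ^ (e + 2 * p)) := by
  have h1 : ∀ x ∈ Ioi (0 : ℝ), ((tanhPoly e ((tanhDeriv e)^[2 * p] X) x / x : ℝ) : ℂ) =
      c * (e + 1).ascFactorial (2 * p) * (poleSeries e (e + 1 + 2 * p) x / x) := fun x hx => by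
    push_cast
    rw [tanhPoly_eq_poleSeries he h (2 * p) x hx, pow_mul]
    simp
    ring
  have hpi : (π : ℂ) ≠ 0 := by exact_mod_cast Real.pi_ne_zero
  rw [setIntegral_congr_fun measurableSet_Ioi h1, integral_const_mul,
    integral_poleSeries_div e he p, tsum_inv_poleDist, pow_succ (π : ℂ)]
  field_simp

theorem oddSeries_two {m : ℕ} (hm : 2 ≤ m) :
    oddSeries 2 m = (1 - ((2 : ℂ) ^ m)⁻¹) * riemannZeta m := by
  let f : ℕ → ℂ := fun n => 1 / (n : ℂ) ^ m
  have hs : Summable f := by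
    have := (Real.summable_nat_pow_inv (p := m)).mpr (by omega)
    refine .of_norm ?_
    simpa [f] using this
  have hz : riemannZeta m = ∑' n, f n := zeta_nat_eq_tsum_of_gt_one (by omega)
  have h := tsum_even_add_odd
    (hs.comp_injective (i := fun k : ℕ => 2 * k) fun a b h => by simpa using h)
    (hs.comp_injective (i := fun k : ℕ => 2 * k + 1) fun a b h => by simpa using h)
  have h3 : (fun k => f (2 * k)) = fun k => ((2 : ℂ) ^ m)⁻¹ * f k := by
    ext k
    simp only [f]
    push_cast
    rw [mul_pow]
    simp [mul_comm]
  have h4 : oddSeries 2 m = ∑' k : ℕ, f (2 * k + 1) := by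
    rw [oddSeries]
    congr 1
    ext k
    simp [f]
  rw [h3, tsum_mul_left, ← hz, ← h4] at h
  rw [eq_sub_of_add_eq' h, sub_mul, one_mul]

theorem dirichletBeta_eq_oddSeries {m : ℕ} (hm : 2 ≤ m) :
    dirichletBeta m = oddSeries 1 m := by
  have hs : Summable fun k : ℕ => (-1 : ℂ) ^ k / (2 * (k : ℂ) + 1) ^ (m : ℂ) := by
    have := (Real.summable_nat_pow_inv (p := m)).mpr (by omega)
    have h2 := this.comp_injective (i := fun k : ℕ => 2 * k + 1) fun a b h => by simpa using h
    refine .of_norm (h2.congr fun k => ?_)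
    rw [Complex.cpow_natCast, norm_div, neg_one_pow_norm, norm_pow,
      show (2 * (k : ℂ) + 1) = ((2 * k + 1 : ℕ) : ℂ) by push_cast; ring, Complex.norm_natCast]
    simp
  rw [dirichletBeta, tsum_eq_of_summable_unconditional hs, oddSeries]
  refine tsum_congr fun k => ?_
  rw [Complex.cpow_natCast]
  simp [div_eq_mul_inv]

/-! ### Rational combinations of given constants -/

/-- The rational linear combinations of `v 1, …, v n`. -/
noncomputable def formSpace (v : ℕ → ℂ) (n : ℕ) : Submodule ℚ ℂ :=
  Submodule.span ℚ (v '' (Finset.Icc 1 n : Set ℕ))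

/-- The functions which are absolutely integrable over `s` with integral in `formSpace v n`. -/
noncomputable def formIntegrals (v : ℕ → ℂ) (n : ℕ) (s : Set ℝ) : Submodule ℚ (ℝ → ℂ) where
  carrier := {f | IntegrableOn f s ∧ ∫ x in s, f x ∈ formSpace v n}
  add_mem' := fun {f g} hf hg => by
    refine ⟨hf.1.add hg.1, ?_⟩
    have := integral_add hf.1 hg.1
    simp only [Pi.add_apply]
    rw [this]
    exact add_mem hf.2 hg.2
  zero_mem' := ⟨integrableOn_zero, by simp⟩
  smul_mem' := fun c f hf => by
    have h : c • f = fun x => (c : ℂ) * f x := by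
      ext x; simp [Rat.smul_def]
    rw [h]
    refine ⟨hf.1.const_mul _, ?_⟩
    rw [integral_const_mul, ← Rat.smul_def]
    exact Submodule.smul_mem _ _ hf.2

theorem mem_formIntegrals {v : ℕ → ℂ} {n : ℕ} {s : Set ℝ} {f : ℝ → ℂ} :
    f ∈ formIntegrals v n s ↔ IntegrableOn f s ∧ ∫ x in s, f x ∈ formSpace v n := Iff.rfl

theorem mem_formSpace_iff {v : ℕ → ℂ} {n : ℕ} {I : ℂ} :
    I ∈ formSpace v n ↔ ∃ C : ℕ → ℚ, I = ∑ p ∈ Finset.Icc 1 n, (C p : ℂ) * v p := by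
  rw [formSpace, Submodule.mem_span_image_finset_iff_exists_fun']
  simp only [Rat.smul_def, eq_comm]

theorem formSpace_mono (v : ℕ → ℂ) {m n : ℕ} (h : m ≤ n) : formSpace v m ≤ formSpace v n := by
  refine Submodule.span_mono (image_mono ?_)
  exact_mod_cast Finset.Icc_subset_Icc_right h

theorem formIntegrals_mono (v : ℕ → ℂ) {m n : ℕ} (h : m ≤ n) (s : Set ℝ) :
    formIntegrals v m s ≤ formIntegrals v n s := fun _ hf => ⟨hf.1, formSpace_mono v h hf.2⟩

theorem formIntegrals_congr {v : ℕ → ℂ} {n : ℕ} {s : Set ℝ} (hs : MeasurableSet s) {f g : ℝ → ℂ}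
    (h : ∀ x ∈ s, f x = g x) : f ∈ formIntegrals v n s ↔ g ∈ formIntegrals v n s := by
  rw [mem_formIntegrals, mem_formIntegrals, integrableOn_congr_fun h hs,
    setIntegral_congr_fun hs h]

/-- `ζ(2p+1) / π^(2p)` for `e = 2`, and `β(2p) / π^(2p-1)` otherwise; only `e = 1` and `e = 2` are
used. -/
noncomputable def formValue (e p : ℕ) : ℂ :=
  if e = 2 then riemannZeta (2 * (p : ℂ) + 1) / (π : ℂ) ^ (2 * p)
  else dirichletBeta (2 * (p : ℂ)) / (π : ℂ) ^ (2 * p - 1)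

theorem hasZetaFormIntegral_iff {n : ℕ} {s : Set ℝ} {f : ℝ → ℂ} :
    HasZetaFormIntegral n s f ↔ f ∈ formIntegrals (formValue 2) n s := by
  rw [HasZetaFormIntegral, IsZetaForm, mem_formIntegrals, mem_formSpace_iff]
  simp only [formValue, if_true]

theorem hasBetaFormIntegral_iff {n : ℕ} {s : Set ℝ} {f : ℝ → ℂ} :
    HasBetaFormIntegral n s f ↔ f ∈ formIntegrals (formValue 1) n s := by
  rw [HasBetaFormIntegral, IsBetaForm, mem_formIntegrals, mem_formSpace_iff]
  simp [formValue]

theorem exists_integral_tanhPoly_iterate_div {e : ℕ} (he : e = 1 ∨ e = 2) (p : ℕ) :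
    ∃ q : ℚ, ∫ x in Ioi (0 : ℝ), ((tanhPoly e ((tanhDeriv e)^[2 * p] X) x / x : ℝ) : ℂ) =
      q * formValue e (p + 1) := by
  rcases he with rfl | rfl
  · refine ⟨(1 + 1).ascFactorial (2 * p) * 2 ^ (1 + 2 * p + 1) * (-1) ^ p, ?_⟩
    rw [integral_tanhPoly_iterate_div le_rfl (fun x hx => tanhPoly_one_X hx),
      ← dirichletBeta_eq_oddSeries (by omega), formValue, if_neg (by norm_num)]
    have h1 : Complex.I * (Complex.I ^ (1 + 2 * p))⁻¹ = (-1) ^ p := by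
      rw [pow_add, pow_mul, Complex.I_sq]
      rcases Nat.even_or_odd p with h | h <;> simp [h.neg_one_pow]
    have h2 : 2 * (p + 1) - 1 = 1 + 2 * p := by omega
    rw [h1, h2]
    push_cast
    congr 4
    ring
  · refine ⟨(2 + 1).ascFactorial (2 * p) * 2 ^ (2 + 2 * p + 1) * (-1) ^ p *
      (1 - (2 ^ (2 + 2 * p + 1))⁻¹), ?_⟩
    rw [integral_tanhPoly_iterate_div one_le_two (fun x hx => tanhPoly_two_X hx),
      oddSeries_two (by omega), formValue, if_pos rfl]
    have h1 : -1 * (Complex.I ^ (2 + 2 * p))⁻¹ = (-1) ^ p := by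
      rw [pow_add, pow_mul, Complex.I_sq]
      rcases Nat.even_or_odd p with h | h <;> simp [h.neg_one_pow]
    have h2 : 2 * (p + 1) = 2 + 2 * p := by omega
    have h3 : ((2 + 2 * p + 1 : ℕ) : ℂ) = 2 * ((p + 1 : ℕ) : ℂ) + 1 := by push_cast; ring
    rw [h1, h2, h3]
    push_cast
    ring

/-- The map which sends `P` to the integrand `P(tanh x) / (x cosh x ^ e)`. -/
noncomputable def tanhIntegrand (e : ℕ) : ℚ[X] →ₗ[ℚ] (ℝ → ℂ) where
  toFun P x := ((tanhPoly e P x / x : ℝ) : ℂ)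
  map_add' P Q := by
    ext x; simp [tanhPoly, add_div]
  map_smul' c P := by
    ext x; simp [tanhPoly, Rat.smul_def, mul_div_assoc]

theorem tanhIntegrand_apply (e : ℕ) (P : ℚ[X]) (x : ℝ) :
    tanhIntegrand e P x = ((tanhPoly e P x / x : ℝ) : ℂ) := rfl

theorem tanhIntegrand_iterate_mem {e : ℕ} (he : e = 1 ∨ e = 2) (p : ℕ) :
    tanhIntegrand e ((tanhDeriv e)^[2 * p] X) ∈ formIntegrals (formValue e) (p + 1) (Ioi 0) := by
  refine ⟨integrableOn_tanhPoly_div (by omega) (eval_zero_tanhDeriv_iterate e p), ?_⟩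
  obtain ⟨q, hq⟩ := exists_integral_tanhPoly_iterate_div he p
  simp only [tanhIntegrand_apply]
  rw [hq, ← Rat.smul_def]
  exact Submodule.smul_mem _ _ (Submodule.subset_span ⟨p + 1, by simp, rfl⟩)

/-- Every odd polynomial of degree less than `2 n` gives a rational combination of the first `n`
constants. -/
theorem tanhIntegrand_mem {e : ℕ} (he : e = 1 ∨ e = 2) {n : ℕ} {P : ℚ[X]} (hP : P ∈ oddPoly n) :
    tanhIntegrand e P ∈ formIntegrals (formValue e) n (Ioi 0) := by
  have : derivSpan e n ≤ (formIntegrals (formValue e) n (Ioi 0)).comap (tanhIntegrand e) := by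
    refine Submodule.span_le.mpr ?_
    rintro _ ⟨i, hi, rfl⟩
    exact formIntegrals_mono _ (Nat.succ_le_of_lt hi) _ (tanhIntegrand_iterate_mem he i)
  exact this (oddPoly_le_derivSpan e n hP)

end Series

section Applications
open Polynomial

/-! ### Hyperbolic multiple angles -/

theorem mem_formIntegrals_of_eq {e : ℕ} (he : e = 1 ∨ e = 2) {n : ℕ} {P : ℚ[X]}
    (hP : P ∈ oddPoly n) {f : ℝ → ℂ}
    (h : ∀ x, 0 < x → f x = ((tanhPoly e P x / x : ℝ) : ℂ)) :
    f ∈ formIntegrals (formValue e) n (Ioi 0) :=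
  (formIntegrals_congr measurableSet_Ioi fun x hx => h x hx).mpr (tanhIntegrand_mem he hP)

theorem one_sub_X_sq_pow_mul_mem_oddPoly {n : ℕ} {P : ℚ[X]} (hP : P ∈ oddPoly n) (j : ℕ) :
    (1 - X ^ 2) ^ j * P ∈ oddPoly (n + j) := by
  induction j with
  | zero => simpa using hP
  | succ j ih =>
    have : (1 - X ^ 2) ^ (j + 1) * P = (1 - X ^ 2) ^ j * P - X ^ 2 * ((1 - X ^ 2) ^ j * P) := by
      ring
    rw [this, ← add_assoc]
    exact sub_mem (oddPoly_mono (Nat.le_succ _) ih) (X_sq_mul_mem_oddPoly ih)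

theorem two_mul_mem_oddPoly {n : ℕ} {P : ℚ[X]} (hP : P ∈ oddPoly n) :
    2 * P ∈ oddPoly n := by
  rw [two_mul]
  exact add_mem hP hP

/-- The polynomial `A` with `sinh (N x) = cosh x ^ N * A(tanh x)`. -/
noncomputable def sinhPoly : ℕ → ℚ[X]
  | 0 => 0
  | 1 => X
  | N + 2 => 2 * sinhPoly (N + 1) - (1 - X ^ 2) * sinhPoly N

theorem sinhPoly_mem_oddPoly (N : ℕ) : sinhPoly N ∈ oddPoly ((N + 1) / 2) := by
  induction N using Nat.twoStepInduction with
  | zero => exact zero_mem _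
  | one => exact X_mem_oddPoly one_pos
  | more N h0 h1 =>
    rw [sinhPoly]
    refine sub_mem (two_mul_mem_oddPoly (oddPoly_mono (by omega) h1)) ?_
    have := one_sub_X_sq_pow_mul_mem_oddPoly h0 1
    rw [pow_one] at this
    exact oddPoly_mono (by omega) this

theorem sinh_natCast_mul (N : ℕ) (x : ℝ) :
    Real.sinh (N * x) = Real.cosh x ^ N * aeval (Real.tanh x) (sinhPoly N) := by
  induction N using Nat.twoStepInduction with
  | zero => simp [sinhPoly]
  | one =>
    have := (Real.cosh_pos x).ne'
    simp [sinhPoly, Real.tanh_eq_sinh_div_cosh]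
    field_simp
  | more N h0 h1 =>
    have hr : Real.sinh ((N + 2 : ℕ) * x) =
        2 * Real.cosh x * Real.sinh ((N + 1 : ℕ) * x) - Real.sinh (N * x) := by
      have e1 : ((N + 2 : ℕ) : ℝ) * x = (N + 1 : ℕ) * x + x := by push_cast; ring
      have e2 : (N : ℝ) * x = (N + 1 : ℕ) * x - x := by push_cast; ring
      rw [e1, e2, Real.sinh_add, Real.sinh_sub]; ring
    have ht : aeval (Real.tanh x) (1 - X ^ 2 : ℚ[X]) = 1 / Real.cosh x ^ 2 := by
      rw [← one_sub_tanh_sq]; simp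
    have := (Real.cosh_pos x).ne'
    rw [hr, h0, h1, sinhPoly, map_sub, map_mul, map_mul, ht, map_ofNat]
    field_simp
    ring

/-- Here `1 / cosh ^ (2 j)` contributes the factor `(1 - X ^ 2) ^ j` to the polynomial. -/
theorem sinh_div_mem {e : ℕ} (he : e = 1 ∨ e = 2) {n N : ℕ} (j : ℕ) (hn : (N + 1) / 2 + j = n) :
    (fun x : ℝ => ((Real.sinh (N * x) / (x * Real.cosh x ^ (N + 2 * j + e)) : ℝ) : ℂ)) ∈
      formIntegrals (formValue e) n (Ioi 0) := by
  refine mem_formIntegrals_of_eq he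
    (hn ▸ one_sub_X_sq_pow_mul_mem_oddPoly (sinhPoly_mem_oddPoly N) j) fun x hx => ?_
  congr 1
  have ht : aeval (Real.tanh x) (1 - X ^ 2 : ℚ[X]) = 1 / Real.cosh x ^ 2 := by
    rw [← one_sub_tanh_sq]; simp
  have := (Real.cosh_pos x).ne'
  rw [sinh_natCast_mul, tanhPoly, map_mul, map_pow, ht, pow_add, pow_add, pow_mul,
    one_div, inv_pow]
  field_simp

/-! ### Changes of variables -/

theorem formIntegrals_image_iff {v : ℕ → ℂ} {n : ℕ} {φ φ' : ℝ → ℝ}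
    (hd : ∀ x ∈ Ioi (0 : ℝ), HasDerivAt φ (φ' x) x) (hi : InjOn φ (Ioi 0)) {f : ℝ → ℂ} :
    f ∈ formIntegrals v n (φ '' Ioi 0) ↔
      (fun x => ((|φ' x| : ℝ) : ℂ) * f (φ x)) ∈ formIntegrals v n (Ioi 0) := by
  have hd' : ∀ x ∈ Ioi (0 : ℝ), HasDerivWithinAt φ (φ' x) (Ioi 0) x :=
    fun x hx => (hd x hx).hasDerivWithinAt
  rw [mem_formIntegrals, mem_formIntegrals,
    integrableOn_image_iff_integrableOn_abs_deriv_smul measurableSet_Ioi hd' hi,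
    integral_image_eq_integral_abs_deriv_smul measurableSet_Ioi hd' hi]
  simp only [Complex.real_smul]

theorem tanh_image_Ioi : Real.tanh '' Ioi 0 = Ioo 0 1 := by
  ext y
  constructor
  · rintro ⟨x, hx, rfl⟩
    have hx : 0 < x := hx
    refine ⟨?_, Real.tanh_lt_one x⟩
    rw [Real.tanh_eq_sinh_div_cosh]
    exact div_pos (Real.sinh_pos_iff.mpr hx) (Real.cosh_pos x)
  · rintro hy
    exact ⟨Real.artanh y, Real.artanh_pos hy, Real.tanh_artanh ⟨by linarith [hy.1], hy.2⟩⟩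

theorem mem_formIntegrals_Ioo_iff_tanh {v : ℕ → ℂ} {n : ℕ} {f : ℝ → ℂ} :
    f ∈ formIntegrals v n (Ioo 0 1) ↔
      (fun x => ((|1 / Real.cosh x ^ 2| : ℝ) : ℂ) * f (Real.tanh x)) ∈
        formIntegrals v n (Ioi 0) := by
  rw [← tanh_image_Ioi]
  exact formIntegrals_image_iff (fun x _ => hasDerivAt_tanh x) Real.tanh_injective.injOn

theorem exp_neg_image_Ioi : (fun u : ℝ => Real.exp (-u)) '' Ioi 0 = Ioo 0 1 := by
  ext y
  constructor
  · rintro ⟨x, hx, rfl⟩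
    have hx : 0 < x := hx
    exact ⟨Real.exp_pos _, by simpa using hx⟩
  · rintro hy
    exact ⟨-Real.log y, by simpa using Real.log_neg hy.1 hy.2, by simp [Real.exp_log hy.1]⟩

theorem hasDerivAt_exp_neg (x : ℝ) :
    HasDerivAt (fun u : ℝ => Real.exp (-u)) (-Real.exp (-x)) x := by
  simpa using (hasDerivAt_neg x).exp

theorem exp_neg_injective : Function.Injective (fun u : ℝ => Real.exp (-u)) :=
  fun a b h => by simpa using h

theorem mem_formIntegrals_Ioo_iff_exp {v : ℕ → ℂ} {n : ℕ} {f : ℝ → ℂ} :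
    f ∈ formIntegrals v n (Ioo 0 1) ↔
      (fun x => ((|-Real.exp (-x)| : ℝ) : ℂ) * f (Real.exp (-x))) ∈
        formIntegrals v n (Ioi 0) := by
  rw [← exp_neg_image_Ioi]
  exact formIntegrals_image_iff (fun x _ => hasDerivAt_exp_neg x) exp_neg_injective.injOn

theorem arctan_exp_neg_image_Ioi :
    (fun u : ℝ => Real.arctan (Real.exp (-u))) '' Ioi 0 = Ioo 0 (π / 4) := by
  have h : (fun u : ℝ => Real.arctan (Real.exp (-u))) '' Ioi 0 = Real.arctan '' Ioo 0 1 := by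
    rw [← exp_neg_image_Ioi, image_image]
  rw [h]
  ext y
  constructor
  · rintro ⟨x, hx, rfl⟩
    refine ⟨Real.arctan_pos.mpr hx.1, ?_⟩
    rw [← Real.arctan_one]
    exact Real.arctan_strictMono hx.2
  · rintro hy
    have hπ := Real.pi_pos
    have h1 : Real.arctan (Real.tan y) = y :=
      Real.arctan_tan (by linarith [hy.1]) (by linarith [hy.2])
    refine ⟨Real.tan y, ⟨Real.tan_pos_of_pos_of_lt_pi_div_two hy.1 (by linarith [hy.2]), ?_⟩, h1⟩
    by_contra hc
    have := Real.arctan_strictMono.monotone (not_lt.mp hc)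
    rw [Real.arctan_one, h1] at this
    linarith [hy.2]

theorem exp_neg_div_one_add_sq (x : ℝ) :
    Real.exp (-x) / (1 + Real.exp (-x) ^ 2) = 1 / (2 * Real.cosh x) := by
  have h1 : 1 + Real.exp (-x) ^ 2 ≠ 0 := by positivity
  have h2 := Real.cosh_pos x
  rw [div_eq_div_iff h1 (by positivity), Real.cosh_eq]
  have : Real.exp (-x) * Real.exp x = 1 := by rw [← Real.exp_add]; simp
  linear_combination this

theorem mem_formIntegrals_Ioo_iff_arctan {v : ℕ → ℂ} {n : ℕ} {f : ℝ → ℂ} :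
    f ∈ formIntegrals v n (Ioo 0 (π / 4)) ↔
      (fun x => ((|-(1 / (2 * Real.cosh x))| : ℝ) : ℂ) * f (Real.arctan (Real.exp (-x)))) ∈
        formIntegrals v n (Ioi 0) := by
  rw [← arctan_exp_neg_image_Ioi]
  refine formIntegrals_image_iff (fun x _ => ?_)
    (Real.arctan_injective.comp exp_neg_injective).injOn
  refine (hasDerivAt_exp_neg x).arctan.congr_deriv ?_
  rw [← exp_neg_div_one_add_sq]
  ring

theorem artanh_integrand_mem {n : ℕ} (hn : 1 ≤ n) :
    (fun x : ℝ => ((x ^ (2 * n - 1) / Real.artanh x : ℝ) : ℂ)) ∈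
      formIntegrals (formValue 2) n (Ioo 0 1) := by
  rw [mem_formIntegrals_Ioo_iff_tanh]
  have hm := X_pow_mem_oddPoly (i := n - 1) (n := n) (by omega)
  rw [show 2 * (n - 1) + 1 = 2 * n - 1 by omega] at hm
  refine mem_formIntegrals_of_eq (Or.inr rfl) hm fun x hx => ?_
  rw [← Complex.ofReal_mul, Real.artanh_tanh, tanhPoly, abs_of_pos (by positivity)]
  congr 1
  simp
  ring

theorem sqrt_artanh_integrand_mem {n : ℕ} (hn : 1 ≤ n) :
    (fun x : ℝ => ((x ^ (2 * n - 1) / (Real.sqrt (1 - x ^ 2) * Real.artanh x) : ℝ) : ℂ)) ∈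
      formIntegrals (formValue 1) n (Ioo 0 1) := by
  rw [mem_formIntegrals_Ioo_iff_tanh]
  have hm := X_pow_mem_oddPoly (i := n - 1) (n := n) (by omega)
  rw [show 2 * (n - 1) + 1 = 2 * n - 1 by omega] at hm
  refine mem_formIntegrals_of_eq (Or.inl rfl) hm fun x hx => ?_
  have hc := Real.cosh_pos x
  have hs : Real.sqrt (1 - Real.tanh x ^ 2) = 1 / Real.cosh x := by
    rw [one_sub_tanh_sq, Real.sqrt_eq_iff_mul_self_eq_of_pos (by positivity)]
    field_simp
  rw [← Complex.ofReal_mul, Real.artanh_tanh, tanhPoly, abs_of_pos (by positivity), hs]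
  congr 1
  simp
  field_simp

/-! ### Multiple angles and the substitution `tan x = exp (-u)` -/

/-- The polynomial `Q` with `sin (2 n θ) = sin θ * Q(cos θ)`. -/
noncomputable def sinPoly : ℕ → ℚ[X]
  | 0 => 0
  | 1 => 2 * X
  | n + 2 => 2 * (2 * (X ^ 2 * sinPoly (n + 1)) - sinPoly (n + 1)) - sinPoly n

/-- The polynomial `R` with `cos ((2 n + 1) θ) = R(cos θ)`. -/
noncomputable def cosPoly : ℕ → ℚ[X]
  | 0 => X
  | 1 => 2 * (2 * (X ^ 2 * X) - X) - X
  | n + 2 => 2 * (2 * (X ^ 2 * cosPoly (n + 1)) - cosPoly (n + 1)) - cosPoly n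

theorem angle_recursion_mem_oddPoly {n : ℕ} {P Q : ℚ[X]} (hP : P ∈ oddPoly n)
    (hQ : Q ∈ oddPoly (n + 1)) :
    2 * (2 * (X ^ 2 * P) - P) - Q ∈ oddPoly (n + 1) :=
  sub_mem (two_mul_mem_oddPoly (sub_mem (two_mul_mem_oddPoly (X_sq_mul_mem_oddPoly hP))
    (oddPoly_mono (Nat.le_succ n) hP))) hQ

theorem sinPoly_mem_oddPoly (n : ℕ) : sinPoly n ∈ oddPoly n := by
  induction n using Nat.twoStepInduction with
  | zero => exact zero_mem _
  | one => exact two_mul_mem_oddPoly (X_mem_oddPoly one_pos)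
  | more n h0 h1 =>
    exact angle_recursion_mem_oddPoly h1 (oddPoly_mono (by omega) h0)

theorem cosPoly_mem_oddPoly (n : ℕ) : cosPoly n ∈ oddPoly (n + 1) := by
  induction n using Nat.twoStepInduction with
  | zero => exact X_mem_oddPoly one_pos
  | one => exact angle_recursion_mem_oddPoly (X_mem_oddPoly one_pos) (X_mem_oddPoly two_pos)
  | more n h0 h1 =>
    exact angle_recursion_mem_oddPoly h1 (oddPoly_mono (by omega) h0)

theorem sin_two_mul_natCast_mul (n : ℕ) (θ : ℝ) :
    Real.sin (2 * n * θ) = Real.sin θ * aeval (Real.cos θ) (sinPoly n) := by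
  induction n using Nat.twoStepInduction with
  | zero => simp [sinPoly]
  | one =>
    simp only [sinPoly, map_mul, aeval_X, map_ofNat, Nat.cast_one, mul_one, Real.sin_two_mul]
    ring
  | more n h0 h1 =>
    have e1 : 2 * ((n + 2 : ℕ) : ℝ) * θ = 2 * (n + 1 : ℕ) * θ + 2 * θ := by push_cast; ring
    have e2 : 2 * (n : ℝ) * θ = 2 * (n + 1 : ℕ) * θ - 2 * θ := by push_cast; ring
    rw [e2, Real.sin_sub, Real.cos_two_mul] at h0
    rw [e1, Real.sin_add, Real.cos_two_mul]
    simp only [sinPoly, map_sub, map_mul, map_pow, aeval_X, map_ofNat]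
    push_cast at h0 h1 ⊢
    linear_combination -h0 + 2 * (2 * Real.cos θ ^ 2 - 1) * h1

theorem cos_odd_mul (n : ℕ) (θ : ℝ) :
    Real.cos ((2 * n + 1) * θ) = aeval (Real.cos θ) (cosPoly n) := by
  induction n using Nat.twoStepInduction with
  | zero => simp [cosPoly]
  | one =>
    have h3 : (2 * ((1 : ℕ) : ℝ) + 1) * θ = 3 * θ := by push_cast; ring
    rw [h3, Real.cos_three_mul]
    simp only [cosPoly, map_sub, map_mul, map_pow, aeval_X, map_ofNat]
    ring
  | more n h0 h1 =>
    have e1 : (2 * ((n + 2 : ℕ) : ℝ) + 1) * θ = (2 * (n + 1 : ℕ) + 1) * θ + 2 * θ := by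
      push_cast; ring
    have e2 : (2 * (n : ℝ) + 1) * θ = (2 * (n + 1 : ℕ) + 1) * θ - 2 * θ := by push_cast; ring
    rw [e2, Real.cos_sub, Real.cos_two_mul] at h0
    rw [e1, Real.cos_add, Real.cos_two_mul]
    simp only [cosPoly, map_sub, map_mul, map_pow, aeval_X, map_ofNat]
    push_cast at h0 h1 ⊢
    linear_combination -h0 + 2 * (2 * Real.cos θ ^ 2 - 1) * h1

theorem sin_two_mul_arctan_exp_neg (x : ℝ) :
    Real.sin (2 * Real.arctan (Real.exp (-x))) = 1 / Real.cosh x := by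
  have h : Real.sqrt (1 + Real.exp (-x) ^ 2) ^ 2 = 1 + Real.exp (-x) ^ 2 :=
    Real.sq_sqrt (by positivity)
  have h0 : Real.sqrt (1 + Real.exp (-x) ^ 2) ≠ 0 := by positivity
  have h2 := exp_neg_div_one_add_sq x
  rw [Real.sin_two_mul, Real.sin_arctan, Real.cos_arctan, mul_assoc, div_mul_div_comm, ← sq, h,
    mul_one, h2]
  field_simp

theorem cos_two_mul_arctan_exp_neg (x : ℝ) :
    Real.cos (2 * Real.arctan (Real.exp (-x))) = Real.tanh x := by
  have h : (1 + Real.exp (-x) ^ 2) ≠ 0 := by positivity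
  rw [Real.cos_two_mul, Real.cos_sq_arctan, Real.tanh_eq]
  have h3 : Real.exp x + Real.exp (-x) ≠ 0 := by positivity
  have : Real.exp (-x) * Real.exp x = 1 := by rw [← Real.exp_add]; simp
  field_simp
  linear_combination (-2 * Real.exp (-x)) * this

theorem log_tan_arctan_exp_neg (x : ℝ) :
    Real.log (Real.tan (Real.arctan (Real.exp (-x)))) = -x := by
  rw [Real.tan_arctan, Real.log_exp]

theorem sin_div_log_tan_mem (n : ℕ) :
    (fun x : ℝ => ((Real.sin (4 * (n : ℝ) * x) / Real.log (Real.tan x) : ℝ) : ℂ)) ∈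
      formIntegrals (formValue 2) n (Ioo 0 (π / 4)) := by
  rw [mem_formIntegrals_Ioo_iff_arctan]
  refine mem_formIntegrals_of_eq (Or.inr rfl)
    (Submodule.smul_mem _ (-1 / 2 : ℚ) (sinPoly_mem_oddPoly n)) fun x hx => ?_
  have hc := Real.cosh_pos x
  rw [← Complex.ofReal_mul, log_tan_arctan_exp_neg, abs_neg, abs_of_pos (by positivity),
    show 4 * (n : ℝ) * Real.arctan (Real.exp (-x)) =
      2 * n * (2 * Real.arctan (Real.exp (-x))) by ring, sin_two_mul_natCast_mul,
    sin_two_mul_arctan_exp_neg, cos_two_mul_arctan_exp_neg, tanhPoly, map_smul, Rat.smul_def]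
  congr 1
  push_cast
  field_simp

theorem cos_div_log_tan_mem {n : ℕ} (hn : 1 ≤ n) :
    (fun x : ℝ => ((Real.cos ((4 * (n : ℝ) - 2) * x) / Real.log (Real.tan x) : ℝ) : ℂ)) ∈
      formIntegrals (formValue 1) n (Ioo 0 (π / 4)) := by
  obtain ⟨m, rfl⟩ := Nat.exists_eq_add_of_le' hn
  rw [mem_formIntegrals_Ioo_iff_arctan]
  refine mem_formIntegrals_of_eq (Or.inl rfl)
    (Submodule.smul_mem _ (-1 / 2 : ℚ) (cosPoly_mem_oddPoly m)) fun x hx => ?_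
  have hc := Real.cosh_pos x
  rw [← Complex.ofReal_mul, log_tan_arctan_exp_neg, abs_neg, abs_of_pos (by positivity),
    show (4 * ((m + 1 : ℕ) : ℝ) - 2) * Real.arctan (Real.exp (-x)) =
      (2 * m + 1) * (2 * Real.arctan (Real.exp (-x))) by push_cast; ring, cos_odd_mul,
    cos_two_mul_arctan_exp_neg, tanhPoly, map_smul, Rat.smul_def]
  congr 1
  push_cast
  field_simp

/-! ### Powers of `tanh x / x` -/

theorem tanh_pow_div_le {a r : ℕ} (hr : r ≤ a) {x : ℝ} (hx : 0 < x) :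
    Real.tanh x ^ a / x ^ r ≤ (Real.tanh x / x) ^ r := by
  have h0 := tanh_nonneg hx.le
  rw [div_pow]
  gcongr ?_ / _
  exact pow_le_pow_of_le_one h0 (Real.tanh_lt_one x).le hr

theorem tanh_div_self_le_one {x : ℝ} (hx : 0 < x) : Real.tanh x / x ≤ 1 :=
  (div_le_one hx).mpr (tanh_le_self hx.le)

theorem integrableOn_tanh_pow_div {a r : ℕ} (h2 : 2 ≤ r) (hr : r ≤ a) :
    IntegrableOn (fun x : ℝ => Real.tanh x ^ a / x ^ r) (Ioi 0) := by
  refine Integrable.mono' ((integrable_inv_one_add_sq.integrableOn (s := Ioi 0)).const_mul 2) ?_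
    ((ae_restrict_mem measurableSet_Ioi).mono fun x hx => ?_)
  · have hc : Continuous Real.tanh :=
      continuous_iff_continuousAt.mpr fun x => (hasDerivAt_tanh x).continuousAt
    exact ((hc.pow a).continuousOn.div (continuous_pow r).continuousOn
      fun x hx => pow_ne_zero r (mem_Ioi.mp hx).ne').aestronglyMeasurable measurableSet_Ioi
  · have hx : 0 < x := hx
    have h0 := tanh_nonneg hx.le
    rw [Real.norm_of_nonneg (by positivity)]
    calc _ ≤ (Real.tanh x / x) ^ r := tanh_pow_div_le hr hx
      _ ≤ (Real.tanh x / x) ^ 2 :=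
        pow_le_pow_of_le_one (by positivity) (tanh_div_self_le_one hx) h2
      _ ≤ _ := by
        rw [div_pow, div_le_iff₀ (by positivity), ← div_eq_mul_inv, div_mul_eq_mul_div,
          le_div_iff₀ (by positivity)]
        have h1 := tanh_le_self hx.le
        have h3 := (Real.tanh_lt_one x).le
        have h4 : Real.tanh x ^ 2 ≤ x ^ 2 := by gcongr
        have h5 : Real.tanh x ^ 2 ≤ 1 := pow_le_one₀ h0 h3
        nlinarith [sq_nonneg x]

theorem hasDerivAt_tanh_pow_div (a r : ℕ) {x : ℝ} (hx : x ≠ 0) :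
    HasDerivAt (fun x : ℝ => -((r : ℝ) + 1)⁻¹ * (Real.tanh x ^ (a + 1) / x ^ (r + 1)))
      (Real.tanh x ^ (a + 1) / x ^ (r + 2) -
        ((a : ℝ) + 1) / (r + 1) * (Real.tanh x ^ a / Real.cosh x ^ 2 / x ^ (r + 1))) x := by
  have h := (((hasDerivAt_tanh x).pow (a + 1)).div (hasDerivAt_pow (r + 1) x)
    (pow_ne_zero _ hx)).const_mul (-((r : ℝ) + 1)⁻¹)
  refine h.congr_deriv ?_
  have hc := (Real.cosh_pos x).ne'
  simp only [Nat.add_sub_cancel, Pi.pow_apply]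
  push_cast
  field_simp
  ring

/-- Integration by parts lowers the power of `x` in the denominator. -/
theorem tanh_pow_div_mem_of_mem {v : ℕ → ℂ} {n a r : ℕ} (hr : r + 1 ≤ a)
    (hm : (fun x : ℝ => ((Real.tanh x ^ a / Real.cosh x ^ 2 / x ^ (r + 1) : ℝ) : ℂ)) ∈
      formIntegrals v n (Ioi 0)) :
    (fun x : ℝ => ((Real.tanh x ^ (a + 1) / x ^ (r + 2) : ℝ) : ℂ)) ∈
      formIntegrals v n (Ioi 0) := by
  have hi := integrableOn_tanh_pow_div (a := a + 1) (r := r + 2) (by omega) (by omega)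
  refine ⟨hi.ofReal, ?_⟩
  have hi2 : IntegrableOn (fun x : ℝ => Real.tanh x ^ a / Real.cosh x ^ 2 / x ^ (r + 1)) (Ioi 0) :=
    hm.1.re
  have hb : ∀ x : ℝ, 0 < x → ‖Real.tanh x ^ (a + 1) / x ^ (r + 1)‖ ≤ Real.tanh x / x :=
      fun x hx => by
    have h0 := tanh_nonneg hx.le
    rw [Real.norm_of_nonneg (by positivity)]
    calc _ ≤ (Real.tanh x / x) ^ (r + 1) := tanh_pow_div_le (by omega) hx
      _ ≤ (Real.tanh x / x) ^ 1 :=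
        pow_le_pow_of_le_one (by positivity) (tanh_div_self_le_one hx) (by omega)
      _ = _ := pow_one _
  have hb2 : ∀ x : ℝ, 0 ≤ x → ‖Real.tanh x ^ (a + 1) / x ^ (r + 1)‖ ≤ x := fun x hx => by
    rcases hx.eq_or_lt with rfl | hx
    · simp
    have h0 := tanh_nonneg hx.le
    have h1 := tanh_le_self hx.le
    rw [Real.norm_of_nonneg (by positivity)]
    calc _ = Real.tanh x ^ a / x ^ (r + 1) * Real.tanh x := by ring
      _ ≤ (Real.tanh x / x) ^ (r + 1) * Real.tanh x := by
        gcongr; exact tanh_pow_div_le hr hx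
      _ ≤ 1 * x := by
        gcongr
        exact pow_le_one₀ (by positivity) (tanh_div_self_le_one hx)
      _ = x := one_mul x
  have hz : ∫ x in Ioi (0 : ℝ), (Real.tanh x ^ (a + 1) / x ^ (r + 2) -
      ((a : ℝ) + 1) / (r + 1) * (Real.tanh x ^ a / Real.cosh x ^ 2 / x ^ (r + 1))) = 0 := by
    have ht : Tendsto (fun x : ℝ => Real.tanh x ^ (a + 1) / x ^ (r + 1)) atTop (𝓝 0) := by
      refine squeeze_zero_norm' ?_ tendsto_inv_atTop_zero
      filter_upwards [eventually_gt_atTop 0] with x hx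
      refine (hb x hx).trans ?_
      rw [← one_div]
      gcongr
      exact (Real.tanh_lt_one x).le
    have ht0 : ContinuousWithinAt (fun x : ℝ => Real.tanh x ^ (a + 1) / x ^ (r + 1)) (Ici 0) 0 := by
      have : Tendsto (fun x : ℝ => x) (𝓝[Ici 0] 0) (𝓝 0) :=
        tendsto_nhdsWithin_of_tendsto_nhds tendsto_id
      have h := squeeze_zero_norm' (f := fun x : ℝ => Real.tanh x ^ (a + 1) / x ^ (r + 1)) (by
        filter_upwards [self_mem_nhdsWithin] with x hx using hb2 x hx) this
      simpa [ContinuousWithinAt] using h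
    rw [integral_Ioi_of_hasDerivAt_of_tendsto (ht0.const_mul _)
      (fun x hx => hasDerivAt_tanh_pow_div a r (mem_Ioi.mp hx).ne') (hi.sub (hi2.const_mul _))
      (ht.const_mul _)]
    simp
  rw [integral_sub hi (hi2.const_mul _), integral_const_mul, sub_eq_zero] at hz
  have hz2 : ∫ x in Ioi (0 : ℝ), ((Real.tanh x ^ (a + 1) / x ^ (r + 2) : ℝ) : ℂ) =
      (((a : ℚ) + 1) / (r + 1) : ℚ) •
        ∫ x in Ioi (0 : ℝ), ((Real.tanh x ^ a / Real.cosh x ^ 2 / x ^ (r + 1) : ℝ) : ℂ) := by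
    rw [integral_complex_ofReal, integral_complex_ofReal, hz, Rat.smul_def]
    push_cast
    ring
  rw [hz2]
  exact Submodule.smul_mem _ _ hm.2

/-- The sum of the two exponents, `a + r + 2 = 2 n + 2`, is preserved or drops by two in each
integration by parts, so that `n` bounds the degree of the form. -/
theorem tanh_pow_div_pow_mem (r : ℕ) : ∀ a n : ℕ, r + 2 ≤ a → a + r = 2 * n →
    (fun x : ℝ => ((Real.tanh x ^ a / x ^ (r + 2) : ℝ) : ℂ)) ∈
      formIntegrals (formValue 2) n (Ioi 0) := by
  induction r with
  | zero =>
    intro a n ha hn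
    obtain ⟨a, rfl⟩ := Nat.exists_eq_add_of_le' (show 1 ≤ a by omega)
    have hm := X_pow_mem_oddPoly (i := n - 1) (n := n) (by omega)
    rw [show 2 * (n - 1) + 1 = a by omega] at hm
    refine tanh_pow_div_mem_of_mem (by omega) (mem_formIntegrals_of_eq (Or.inr rfl) hm ?_)
    intro x hx
    simp [tanhPoly]
  | succ r ih =>
    intro a n ha hn
    obtain ⟨a, rfl⟩ := Nat.exists_eq_add_of_le' (show 1 ≤ a by omega)
    refine tanh_pow_div_mem_of_mem (by omega) ?_
    have h1 := formIntegrals_mono (formValue 2) (Nat.sub_le n 1) _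
      (ih a (n - 1) (by omega) (by omega))
    have h2 := sub_mem h1 (ih (a + 2) n (by omega) (by omega))
    convert! h2 using 1
    ext x
    rw [Pi.sub_apply, ← Complex.ofReal_sub, div_eq_mul_one_div _ (Real.cosh x ^ 2),
      ← one_sub_tanh_sq]
    congr 1
    ring

end Applications

section Logarithm
open Polynomial

/-! ### Integrals against `log` -/

theorem abs_log_le {u : ℝ} (hu : 0 < u) : |Real.log u| ≤ 2 * u ^ (-(1 / 2) : ℝ) + u := by
  have h1 := Real.log_le_rpow_div (inv_pos.mpr hu).le (ε := 1 / 2) (by norm_num)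
  have h2 := Real.log_le_self hu.le
  have h3 : 0 < u ^ (-(1 / 2) : ℝ) := Real.rpow_pos_of_pos hu _
  rw [Real.log_inv, Real.inv_rpow hu.le, ← Real.rpow_neg hu.le] at h1
  rw [abs_le]
  constructor <;> linarith

theorem integrableOn_abs_log_mul_exp_neg :
    IntegrableOn (fun u : ℝ => Real.exp (-u) * (2 * u ^ (-(1 / 2) : ℝ) + u)) (Ioi 0) := by
  have h1 := Real.GammaIntegral_convergent (s := 1 / 2) (by norm_num)
  have h2 := Real.GammaIntegral_convergent (s := 2) (by norm_num)
  refine IntegrableOn.congr_fun (Integrable.add (h1.const_mul 2) h2) (fun u _ => ?_)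
    measurableSet_Ioi
  simp only [Pi.add_apply]
  rw [show (1 / 2 - 1 : ℝ) = -(1 / 2) by norm_num, show (2 - 1 : ℝ) = 1 by norm_num, Real.rpow_one]
  ring

theorem integrableOn_tanhPoly_mul_log {e : ℕ} (he : 1 ≤ e) (P : ℚ[X]) :
    IntegrableOn (fun u => tanhPoly e P u * Real.log u) (Ioi 0) := by
  obtain ⟨C, hC0, hC⟩ := exists_abs_tanhPoly_le he P
  refine Integrable.mono' (integrableOn_abs_log_mul_exp_neg.const_mul C) ?_
    ((ae_restrict_mem measurableSet_Ioi).mono fun u hu => ?_)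
  · exact ((continuous_tanhPoly e P).continuousOn.mul (Real.continuousOn_log.mono
      fun u hu => (mem_Ioi.mp hu).ne')).aestronglyMeasurable measurableSet_Ioi
  · rw [Real.norm_eq_abs, abs_mul]
    calc _ ≤ (C * Real.exp (-u)) * (2 * u ^ (-(1 / 2) : ℝ) + u) :=
          mul_le_mul (hC u) (abs_log_le hu) (abs_nonneg _) (by positivity)
      _ = _ := by ring

/-- Integration by parts; the boundary terms vanish as `P` has no constant term. -/
theorem integral_tanhPoly_tanhDeriv_mul_log {e : ℕ} (he : 1 ≤ e) {P : ℚ[X]} (hP : P.eval 0 = 0) :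
    ∫ u in Ioi (0 : ℝ), tanhPoly e (tanhDeriv e P) u * Real.log u =
      -∫ u in Ioi (0 : ℝ), tanhPoly e P u / u := by
  have hi1 := integrableOn_tanhPoly_mul_log he (tanhDeriv e P)
  have hi2 : IntegrableOn (fun u => tanhPoly e P u / u) (Ioi 0) :=
    (integrableOn_tanhPoly_div he hP).re
  obtain ⟨C, hC0, hC⟩ := exists_abs_tanhPoly_le_mul he hP
  have hd : ∀ u ∈ Ioi (0 : ℝ), HasDerivAt (fun u => tanhPoly e P u * Real.log u)
      (tanhPoly e (tanhDeriv e P) u * Real.log u + tanhPoly e P u / u) u := fun u hu =>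
    ((hasDerivAt_tanhPoly e P u).mul (Real.hasDerivAt_log (mem_Ioi.mp hu).ne')).congr_deriv
      (by rw [div_eq_mul_inv])
  have hb : ∀ u : ℝ, 0 ≤ u → ‖tanhPoly e P u * Real.log u‖ ≤
      C * |u * Real.log u| * Real.exp (-u) := fun u hu => by
    rw [norm_mul, Real.norm_eq_abs, Real.norm_eq_abs, abs_mul, abs_of_nonneg hu]
    calc _ ≤ C * u * Real.exp (-u) * |Real.log u| :=
          mul_le_mul_of_nonneg_right (hC u hu) (abs_nonneg _)
      _ = _ := by ring
  have h0 : ContinuousWithinAt (fun u => tanhPoly e P u * Real.log u) (Ici 0) 0 := by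
    have h1 : Tendsto (fun u : ℝ => C * |u * Real.log u| * Real.exp (-u)) (𝓝[Ici 0] 0) (𝓝 0) := by
      have hc : Continuous fun u : ℝ => C * |u * Real.log u| * Real.exp (-u) := by
        have := Real.continuous_mul_log
        fun_prop
      simpa using (hc.tendsto 0).mono_left nhdsWithin_le_nhds
    have h2 := squeeze_zero_norm' (by
      filter_upwards [self_mem_nhdsWithin] with u hu using hb u hu) h1
    simpa [ContinuousWithinAt] using h2
  have hinf : Tendsto (fun u => tanhPoly e P u * Real.log u) atTop (𝓝 0) := by
    have h1 : Tendsto (fun u : ℝ => C * (u ^ 2 * Real.exp (-u))) atTop (𝓝 0) := by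
      simpa using (Real.tendsto_pow_mul_exp_neg_atTop_nhds_zero 2).const_mul C
    refine squeeze_zero_norm' ?_ h1
    filter_upwards [eventually_ge_atTop 1] with u hu
    refine (hb u (by linarith)).trans ?_
    rw [mul_assoc]
    have hl : Real.log u ≤ u := Real.log_le_self (by linarith)
    have hl0 : 0 ≤ Real.log u := Real.log_nonneg hu
    rw [abs_of_nonneg (by positivity), sq]
    gcongr
  have h := integral_Ioi_of_hasDerivAt_of_tendsto h0 hd (hi1.add hi2) hinf
  simp only [Real.log_zero, mul_zero, sub_zero] at h
  rw [integral_add hi1 hi2] at h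
  linarith

theorem tanhPoly_mul_log_mem {e : ℕ} (he : e = 1 ∨ e = 2) (p : ℕ) :
    (fun u => ((tanhPoly e ((tanhDeriv e)^[2 * p + 1] X) u * Real.log u : ℝ) : ℂ)) ∈
      formIntegrals (formValue e) (p + 1) (Ioi 0) := by
  have he1 : 1 ≤ e := by omega
  refine ⟨(integrableOn_tanhPoly_mul_log he1 _).ofReal, ?_⟩
  rw [integral_complex_ofReal, Function.iterate_succ_apply',
    integral_tanhPoly_tanhDeriv_mul_log he1 (eval_zero_tanhDeriv_iterate e p)]
  have h := (tanhIntegrand_iterate_mem he p).2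
  simp only [tanhIntegrand_apply] at h
  rw [integral_complex_ofReal] at h
  rw [Complex.ofReal_neg]
  exact neg_mem h

/-! ### Polylogarithms of negative order as hyperbolic functions -/

/-- The series `∑_k (-1)^k (2k+c)^m exp (-(2k+c)u)`. -/
noncomputable def expSeries (c m : ℕ) (u : ℝ) : ℝ :=
  ∑' k : ℕ, (-1) ^ k * ((2 * k + c : ℕ) : ℝ) ^ m * Real.exp (-((2 * k + c : ℕ) * u))

theorem summable_pow_mul_exp (c m : ℕ) {r : ℝ} (hr : 0 < r) :
    Summable fun k : ℕ => ((2 * k + c : ℕ) : ℝ) ^ m * Real.exp (-((2 * k + c : ℕ) * r)) := by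
  have h := (Real.summable_pow_mul_exp_neg_nat_mul m hr).comp_injective
    (i := fun k : ℕ => 2 * k + c) fun a b h => by simpa using h
  refine h.congr fun k => ?_
  simp only [Function.comp_apply]
  ring_nf

theorem summable_expSeries (c m : ℕ) {u : ℝ} (hu : 0 < u) :
    Summable fun k : ℕ =>
      (-1) ^ k * ((2 * k + c : ℕ) : ℝ) ^ m * Real.exp (-((2 * k + c : ℕ) * u)) := by
  refine .of_norm ((summable_pow_mul_exp c m hu).congr fun k => ?_)
  rw [norm_mul, norm_mul, norm_pow, norm_neg, norm_one, one_pow, one_mul,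
    Real.norm_of_nonneg (by positivity), Real.norm_of_nonneg (Real.exp_pos _).le]

theorem hasDerivAt_expSeries (c m : ℕ) {u : ℝ} (hu : 0 < u) :
    HasDerivAt (expSeries c m) (-expSeries c (m + 1) u) u := by
  have h := hasDerivAt_tsum_of_isPreconnected (t := Ioi (u / 2)) (y₀ := u) (y := u)
    (summable_pow_mul_exp c (m + 1) (half_pos hu)) isOpen_Ioi isPreconnected_Ioi
    (g := fun k y => (-1) ^ k * ((2 * k + c : ℕ) : ℝ) ^ m * Real.exp (-((2 * k + c : ℕ) * y)))
    (g' := fun k y =>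
      -((-1) ^ k * ((2 * k + c : ℕ) : ℝ) ^ (m + 1) * Real.exp (-((2 * k + c : ℕ) * y))))
    (fun k y _ => by
      have h1 : HasDerivAt (fun y : ℝ => -(((2 * k + c : ℕ) : ℝ) * y))
          (-((2 * k + c : ℕ) : ℝ)) y := by
        simpa using ((hasDerivAt_id y).const_mul ((2 * k + c : ℕ) : ℝ)).fun_neg
      refine (h1.exp.const_mul _).congr_deriv ?_
      ring)
    (fun k y hy => by
      rw [norm_neg, norm_mul, norm_mul, norm_pow, norm_neg, norm_one, one_pow, one_mul,
        Real.norm_of_nonneg (by positivity), Real.norm_of_nonneg (Real.exp_pos _).le]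
      have hy : u / 2 < y := hy
      gcongr)
    (half_lt_self hu) (summable_expSeries c m hu) (half_lt_self hu)
  rw [tsum_neg] at h
  exact h

theorem expSeries_zero (c : ℕ) {u : ℝ} (hu : 0 < u) :
    expSeries c 0 u = Real.exp (-(c * u)) / (1 + Real.exp (-u) ^ 2) := by
  have h1 : |-Real.exp (-u) ^ 2| < 1 := by
    rw [abs_neg, abs_of_pos (by positivity)]
    exact pow_lt_one₀ (Real.exp_pos _).le (by simpa using hu) two_ne_zero
  have h2 := tsum_geometric_of_abs_lt_one h1
  rw [expSeries, div_eq_mul_inv, show 1 + Real.exp (-u) ^ 2 = 1 - -Real.exp (-u) ^ 2 by ring, ← h2,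
    ← tsum_mul_left]
  refine tsum_congr fun k => ?_
  rw [pow_zero, mul_one, neg_pow (Real.exp (-u) ^ 2), ← pow_mul, ← Real.exp_nat_mul, mul_left_comm,
    ← Real.exp_add]
  congr 2
  push_cast
  ring

theorem expSeries_one_one {u : ℝ} (hu : 0 < u) :
    expSeries 1 1 u = 1 / 2 * tanhPoly 1 X u := by
  have h0 : ∀ y, 0 < y → expSeries 1 0 y = 1 / 2 * tanhPoly 1 1 y := fun y hy => by
    rw [expSeries_zero 1 hy, Nat.cast_one, one_mul, exp_neg_div_one_add_sq, tanhPoly, map_one]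
    field_simp
  have h1 := eq_deriv_of_eqOn_Ioi hu h0 (hasDerivAt_expSeries 1 0 hu)
    ((hasDerivAt_tanhPoly 1 1 u).const_mul _)
  have h2 : tanhPoly 1 (tanhDeriv 1 1) u = -tanhPoly 1 X u := by
    rw [tanhDeriv_one]
    simp [tanhPoly, neg_div]
  rw [h2] at h1
  linarith

theorem expSeries_two_two {u : ℝ} (hu : 0 < u) :
    expSeries 2 2 u = tanhPoly 2 X u := by
  have h0 : ∀ y, 0 < y → expSeries 2 0 y = 1 / 2 - 1 / 2 * Real.tanh y := fun y hy => by
    have : Real.exp (-(((2 : ℕ) : ℝ) * y)) = Real.exp (-y) * Real.exp (-y) := by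
      rw [← Real.exp_add]; congr 1; push_cast; ring
    have hc := (Real.cosh_pos y).ne'
    rw [expSeries_zero 2 hy, this, mul_div_assoc, exp_neg_div_one_add_sq,
      Real.tanh_eq_sinh_div_cosh, ← Real.cosh_sub_sinh]
    field_simp
  have h1 : ∀ y, 0 < y → expSeries 2 1 y = 1 / 2 * tanhPoly 2 1 y := fun y hy => by
    have := eq_deriv_of_eqOn_Ioi hy h0 (hasDerivAt_expSeries 2 0 hy)
      (((hasDerivAt_tanh y).const_mul (1 / 2)).const_sub (1 / 2))
    rw [neg_inj] at this
    rw [this, tanhPoly, map_one]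
  have h2 := eq_deriv_of_eqOn_Ioi hu h1 (hasDerivAt_expSeries 2 1 hu)
    ((hasDerivAt_tanhPoly 2 1 u).const_mul _)
  have h3 : tanhPoly 2 (tanhDeriv 2 1) u = -(2 * tanhPoly 2 X u) := by
    rw [tanhDeriv_one]
    simp [tanhPoly, neg_div, Rat.smul_def, mul_div_assoc]
  rw [h3] at h2
  linarith

/-- Both sides satisfy the same differential recursion in `m`. -/
theorem expSeries_eq_tanhPoly {c : ℕ} {κ : ℝ}
    (h : ∀ u, 0 < u → expSeries c c u = κ * tanhPoly c X u) (m : ℕ) :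
    ∀ u, 0 < u → expSeries c (c + m) u = κ * (-1) ^ m * tanhPoly c ((tanhDeriv c)^[m] X) u := by
  induction m with
  | zero => simpa using h
  | succ m ih =>
    intro u hu
    have h1 := eq_deriv_of_eqOn_Ioi hu ih (hasDerivAt_expSeries c (c + m) hu)
      ((hasDerivAt_tanhPoly c _ u).const_mul _)
    rw [Function.iterate_succ_apply', ← add_assoc, pow_succ]
    linarith

theorem expSeries_mul_log_mem {c : ℕ} (hc : c = 1 ∨ c = 2) (p : ℕ) :
    (fun u => ((expSeries c (c + (2 * p + 1)) u * Real.log u : ℝ) : ℂ)) ∈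
      formIntegrals (formValue c) (p + 1) (Ioi 0) := by
  obtain ⟨q, hq⟩ : ∃ q : ℚ, ∀ u, 0 < u → expSeries c c u = q * tanhPoly c X u := by
    rcases hc with rfl | rfl
    · exact ⟨1 / 2, fun u hu => by rw [expSeries_one_one hu]; push_cast; rfl⟩
    · exact ⟨1, fun u hu => by rw [expSeries_two_two hu]; simp⟩
  have h1 := expSeries_eq_tanhPoly hq (2 * p + 1)
  have h2 := Submodule.smul_mem _ (-q) (tanhPoly_mul_log_mem hc p)
  refine (formIntegrals_congr measurableSet_Ioi fun u hu => ?_).mpr h2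
  rw [h1 u hu, Pi.smul_apply, Rat.smul_def, pow_succ, pow_mul]
  push_cast
  simp
  ring

theorem polylog_neg_sq_eq (m : ℕ) (u : ℝ) :
    polylog (-(m : ℂ)) (-(Real.exp (-u) : ℂ) ^ 2) = ((-(1 / 2) ^ m * expSeries 2 m u : ℝ) : ℂ) := by
  rw [polylog, expSeries, ← tsum_mul_left, Complex.ofReal_tsum]
  refine tsum_congr fun k => ?_
  have h1 : (-(Real.exp (-u) : ℂ) ^ 2) ^ (k + 1) =
      ((-(-1) ^ k * Real.exp (-((2 * k + 2 : ℕ) * u)) : ℝ) : ℂ) := by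
    have : Real.exp (-((2 * k + 2 : ℕ) * u)) = (Real.exp (-u) ^ 2) ^ (k + 1) := by
      rw [← pow_mul, ← Real.exp_nat_mul]; congr 1; push_cast; ring
    rw [this, neg_pow]
    push_cast
    ring
  rw [h1, Complex.cpow_neg, Complex.cpow_natCast, div_inv_eq_mul]
  push_cast
  rw [show (2 * (k : ℂ) + 2) = 2 * (k + 1) by ring, mul_pow, one_div, inv_pow]
  field_simp

/-- Only the odd powers of `i x` contribute to the imaginary part. -/
theorem im_polylog_I_mul_eq (m : ℕ) {u : ℝ} (hu : 0 < u) :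
    (polylog (-(m : ℂ)) (Complex.I * (Real.exp (-u) : ℂ))).im = expSeries 1 m u := by
  let f : ℕ → ℂ := fun k =>
    Complex.I ^ (k + 1) * (((k + 1 : ℕ) ^ m * Real.exp (-((k + 1 : ℕ) * u)) : ℝ) : ℂ)
  have hp : polylog (-(m : ℂ)) (Complex.I * (Real.exp (-u) : ℂ)) = ∑' k, f k := by
    rw [polylog]
    refine tsum_congr fun k => ?_
    have : Real.exp (-((k + 1 : ℕ) * u)) = Real.exp (-u) ^ (k + 1) := by
      rw [← Real.exp_nat_mul]; congr 1; ring
    simp only [f]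
    rw [this, mul_pow, Complex.cpow_neg, Complex.cpow_natCast, div_inv_eq_mul]
    push_cast
    ring
  have hs : Summable f := by
    have h := (Real.summable_pow_mul_exp_neg_nat_mul m hu).comp_injective (add_left_injective 1)
    refine .of_norm (h.congr fun k => ?_)
    simp only [Function.comp_apply, f]
    rw [norm_mul, norm_pow, Complex.norm_I, one_pow, one_mul, Complex.norm_real,
      Real.norm_of_nonneg (by positivity)]
    ring_nf
  have he : Summable fun k => f (2 * k) :=
    hs.comp_injective (i := fun k : ℕ => 2 * k) fun a b h => by simpa using h
  have ho : Summable fun k => f (2 * k + 1) :=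
    hs.comp_injective (i := fun k : ℕ => 2 * k + 1) fun a b h => by simpa using h
  rw [hp, ← tsum_even_add_odd he ho, Complex.add_im, Complex.im_tsum he, Complex.im_tsum ho]
  have h2 : ∀ k, (f (2 * k + 1)).im = 0 := fun k => by
    simp only [f]
    rw [show 2 * k + 1 + 1 = 2 * (k + 1) by ring, pow_mul, Complex.I_sq]
    have : ((-1 : ℂ)) ^ (k + 1) = (((-1) ^ (k + 1) : ℝ) : ℂ) := by push_cast; rfl
    rw [this, ← Complex.ofReal_mul, Complex.ofReal_im]
  have h1 : ∀ k, (f (2 * k)).im =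
      (-1) ^ k * ((2 * k + 1 : ℕ) : ℝ) ^ m * Real.exp (-((2 * k + 1 : ℕ) * u)) := fun k => by
    simp only [f]
    rw [pow_succ, pow_mul, Complex.I_sq]
    have : ((-1 : ℂ)) ^ k = (((-1) ^ k : ℝ) : ℂ) := by push_cast; rfl
    rw [this, mul_right_comm, ← Complex.ofReal_mul, Complex.im_ofReal_mul, Complex.I_im]
    ring
  simp only [h1, h2, tsum_zero, add_zero]
  rfl

theorem polylog_integrand_mem {n : ℕ} (hn : 1 ≤ n) :
    (fun x : ℝ => polylog (-2 * (n : ℂ) - 1) (-(x : ℂ) ^ 2) / (x : ℂ) *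
      ((Real.log (Real.log (1 / x)) : ℝ) : ℂ)) ∈ formIntegrals (formValue 2) n (Ioo 0 1) := by
  obtain ⟨p, rfl⟩ := Nat.exists_eq_add_of_le' hn
  rw [mem_formIntegrals_Ioo_iff_exp]
  have h2 := Submodule.smul_mem _ (-(1 / 2) ^ (2 + (2 * p + 1)) : ℚ)
    (expSeries_mul_log_mem (Or.inr rfl) p)
  refine (formIntegrals_congr measurableSet_Ioi fun u hu => ?_).mpr h2
  have hx : (Real.exp (-u) : ℂ) ≠ 0 := by exact_mod_cast (Real.exp_pos _).ne'
  have hm : -2 * ((p + 1 : ℕ) : ℂ) - 1 = -((2 + (2 * p + 1) : ℕ) : ℂ) := by push_cast; ring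
  have hl : Real.log (1 / Real.exp (-u)) = u := by
    rw [one_div, Real.log_inv, Real.log_exp, neg_neg]
  rw [hm, polylog_neg_sq_eq, hl, abs_neg, abs_of_pos (Real.exp_pos _), Pi.smul_apply, Rat.smul_def]
  push_cast
  rw [← Complex.ofReal_neg, ← Complex.ofReal_exp]
  field_simp

theorem im_polylog_integrand_mem {n : ℕ} (hn : 1 ≤ n) :
    (fun x : ℝ => (((polylog (-2 * (n : ℂ)) (Complex.I * (x : ℂ))).im / x *
      Real.log (Real.log (1 / x)) : ℝ) : ℂ)) ∈ formIntegrals (formValue 1) n (Ioo 0 1) := by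
  obtain ⟨p, rfl⟩ := Nat.exists_eq_add_of_le' hn
  rw [mem_formIntegrals_Ioo_iff_exp]
  refine (formIntegrals_congr measurableSet_Ioi fun u hu => ?_).mpr
    (expSeries_mul_log_mem (Or.inl rfl) p)
  have hx := (Real.exp_pos (-u)).ne'
  have hm : -2 * ((p + 1 : ℕ) : ℂ) = -((1 + (2 * p + 1) : ℕ) : ℂ) := by push_cast; ring
  have hl : Real.log (1 / Real.exp (-u)) = u := by
    rw [one_div, Real.log_inv, Real.log_exp, neg_neg]
  rw [hm, im_polylog_I_mul_eq _ hu, hl, abs_neg, abs_of_pos (Real.exp_pos _), ← Complex.ofReal_mul]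
  congr 1
  field_simp

end Logarithm

end TanhIntegral

theorem mainTheorem3 (n : ℕ) (hn : 1 ≤ n) :
    -- integrals that are rational combinations of `ζ(2p+1) / π^{2p}`
    ((∀ k : ℕ, k ≤ n - 1 → HasZetaFormIntegral n (Set.Ioi 0) (fun x : ℝ =>
        ((Real.sinh ((2 * (k : ℝ) + 1) * x) / (x * Real.cosh x ^ (2 * n + 1)) : ℝ) : ℂ))) ∧
      (∀ k : ℕ, 1 ≤ k → k ≤ n → HasZetaFormIntegral n (Set.Ioi 0) (fun x : ℝ =>
        ((Real.sinh (2 * (k : ℝ) * x) / (x * Real.cosh x ^ (2 * n + 2)) : ℝ) : ℂ))) ∧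
      HasZetaFormIntegral n (Set.Ioo 0 (Real.pi / 4)) (fun x : ℝ =>
        ((Real.sin (4 * (n : ℝ) * x) / Real.log (Real.tan x) : ℝ) : ℂ)) ∧
      HasZetaFormIntegral n (Set.Ioo 0 1) (fun x : ℝ =>
        polylog (-2 * (n : ℂ) - 1) (-(x : ℂ) ^ 2) / (x : ℂ) *
          ((Real.log (Real.log (1 / x)) : ℝ) : ℂ)) ∧
      HasZetaFormIntegral n (Set.Ioo 0 1) (fun x : ℝ =>
        ((x ^ (2 * n - 1) / Real.artanh x : ℝ) : ℂ)) ∧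
      HasZetaFormIntegral n (Set.Ioi 0) (fun x : ℝ =>
        ((Real.tanh x ^ (2 * n) / x ^ 2 : ℝ) : ℂ)) ∧
      HasZetaFormIntegral n (Set.Ioi 0) (fun x : ℝ =>
        ((Real.tanh x ^ (n + 1) / x ^ (n + 1) : ℝ) : ℂ))) ∧
    -- integrals that are rational combinations of `β(2p) / π^{2p-1}`
    ((∀ k : ℕ, k ≤ n - 1 → HasBetaFormIntegral n (Set.Ioi 0) (fun x : ℝ =>
        ((Real.sinh ((2 * (k : ℝ) + 1) * x) / (x * Real.cosh x ^ (2 * n)) : ℝ) : ℂ))) ∧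
      (∀ k : ℕ, 1 ≤ k → k ≤ n → HasBetaFormIntegral n (Set.Ioi 0) (fun x : ℝ =>
        ((Real.sinh (2 * (k : ℝ) * x) / (x * Real.cosh x ^ (2 * n + 1)) : ℝ) : ℂ))) ∧
      HasBetaFormIntegral n (Set.Ioo 0 (Real.pi / 4)) (fun x : ℝ =>
        ((Real.cos ((4 * (n : ℝ) - 2) * x) / Real.log (Real.tan x) : ℝ) : ℂ)) ∧
      HasBetaFormIntegral n (Set.Ioo 0 1) (fun x : ℝ =>
        (((polylog (-2 * (n : ℂ)) (Complex.I * (x : ℂ))).im / x *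
          Real.log (Real.log (1 / x)) : ℝ) : ℂ)) ∧
      HasBetaFormIntegral n (Set.Ioo 0 1) (fun x : ℝ =>
        ((x ^ (2 * n - 1) / (Real.sqrt (1 - x ^ 2) * Real.artanh x) : ℝ) : ℂ))) := by
  open TanhIntegral in
  simp only [hasZetaFormIntegral_iff, hasBetaFormIntegral_iff]
  have e2 : (2 : ℕ) = 1 ∨ (2 : ℕ) = 2 := Or.inr rfl
  have e1 : (1 : ℕ) = 1 ∨ (1 : ℕ) = 2 := Or.inl rfl
  refine ⟨⟨fun k hk => ?_, fun k hk hkn => ?_, sin_div_log_tan_mem n, polylog_integrand_mem hn,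
    artanh_integrand_mem hn, ?_, ?_⟩, fun k hk => ?_, fun k hk hkn => ?_, cos_div_log_tan_mem hn,
    im_polylog_integrand_mem hn, sqrt_artanh_integrand_mem hn⟩
  · have h := sinh_div_mem e2 (n := n) (N := 2 * k + 1) (n - 1 - k) (by omega)
    rw [show 2 * k + 1 + 2 * (n - 1 - k) + 2 = 2 * n + 1 by omega] at h
    simpa only [Nat.cast_add, Nat.cast_mul, Nat.cast_ofNat, Nat.cast_one] using h
  · have h := sinh_div_mem e2 (n := n) (N := 2 * k) (n - k) (by omega)
    rw [show 2 * k + 2 * (n - k) + 2 = 2 * n + 2 by omega] at h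
    simpa only [Nat.cast_mul, Nat.cast_ofNat] using h
  · exact tanh_pow_div_pow_mem 0 (2 * n) n (by omega) (by omega)
  · have h := tanh_pow_div_pow_mem (n - 1) (n + 1) n (by omega) (by omega)
    rwa [show n - 1 + 2 = n + 1 by omega] at h
  · have h := sinh_div_mem e1 (n := n) (N := 2 * k + 1) (n - 1 - k) (by omega)
    rw [show 2 * k + 1 + 2 * (n - 1 - k) + 1 = 2 * n by omega] at h
    simpa only [Nat.cast_add, Nat.cast_mul, Nat.cast_ofNat, Nat.cast_one] using h
  · have h := sinh_div_mem e1 (n := n) (N := 2 * k) (n - k) (by omega)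
    rw [show 2 * k + 2 * (n - k) + 1 = 2 * n + 1 by omega] at h
    simpa only [Nat.cast_mul, Nat.cast_ofNat] using h
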